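/- Let $n\ge 1$ and let $(M,\eta,\xi,\phi,g)$ be a contact metric structure on a smooth manifold $M$ of dimension $2n+1$: that is, $\eta$ is a smooth one-form with $\eta\wedge(d\eta)^n$ nowhere zero, $g$ is a Riemannian metric, $\xi$ is a smooth unit vector field, and $\phi$ is a smooth field of endomorphisms of $TM$ such that $$\eta(\xi)=1,\qquad \phi^2=-\mathrm{Id}+\eta\otimes\xi,\qquad \phi\,\xi=0,\qquad d\eta(X,Y)=2g(X,\phi Y),$$ where $d\eta(X,Y)=X(\eta(Y))-Y(\eta(X))-\eta([X,Y])$. Suppose that the structure is generalized Eta-Einstein, that is, the Ricci operator $Q$ of $g$ (defined by $g(QX,Y)=\mathrm{Ric}(X,Y)$) satisfies $$QX=\lambda X+\gamma\,\eta(X)\,\xi$$ for all tangent vectors $X$, where $\lambda$ and $\gamma$ are smooth functions on $M$, and suppose that $\gamma\neq 0$ almost everywhere (the set $\{\gamma=0\}$ has measure zero). Let $Z$ be a Killing vector field on $(M,g)$, that is, a smooth vector field with $L_Zg=0$. Then $Z$ is an infinitesimal automorphism of the contact metric structure: $$L_Z\eta=0,\qquad L_Z\xi=[Z,\xi]=0,\qquad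 L_Z\phi=0,\qquad L_Zg=0.$$ Moreover, $\lambda$ and $\gamma$ are integral invariants of $Z$, that is, $d\lambda(Z)=0=d\gamma(Z)$ on all of $M$. -/

import Mathlib

open Bundle VectorField FiberBundle Module MeasureTheory
open scoped Manifold ContDiff

noncomputable section

namespace ContactMetric

section Riemannian

variable {E : Type*} [NormedAddCommGroup E] [NormedSpace ℝ E] [FiniteDimensional ℝ E]
  {H : Type*} [TopologicalSpace H] {I : ModelWithCorners ℝ E H}
  {M : Type*} [TopologicalSpace M] [ChartedSpace H M] [IsManifold I ∞ M]
  [RiemannianBundle (fun x : M ↦ TangentSpace I x)]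
  [IsContMDiffRiemannianBundle I ∞ E (fun x : M ↦ TangentSpace I x)]

instance finiteDimensional_tangentSpace (x : M) : FiniteDimensional ℝ (TangentSpace I x) :=
  inferInstanceAs (FiniteDimensional ℝ E)

instance completeSpace_tangentSpace (x : M) : CompleteSpace (TangentSpace I x) :=
  FiniteDimensional.complete ℝ _

theorem mdifferentiableAt_inner {Y W : Π x : M, TangentSpace I x} {x : M}
    (hY : MDiffAt (T% Y) x) (hW : MDiffAt (T% W) x) :
    MDiffAt (fun y ↦ inner ℝ (Y y) (W y)) x :=
  MDifferentiableAt.inner_bundle (F := E) (E := fun x : M ↦ TangentSpace I x) (b := id) hY hW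

/-- The right-hand side of the Koszul formula, which is to be `g(∇_X Y, W)` at `x`. -/
def koszul (X Y W : Π x : M, TangentSpace I x) (x : M) : ℝ :=
  (1 / 2) * (mvfderiv I (fun y ↦ inner ℝ (Y y) (W y)) x (X x)
    + mvfderiv I (fun y ↦ inner ℝ (W y) (X y)) x (Y x)
    - mvfderiv I (fun y ↦ inner ℝ (X y) (Y y)) x (W x)
    + inner ℝ (mlieBracket I X Y x) (W x)
    - inner ℝ (mlieBracket I Y W x) (X x)
    + inner ℝ (mlieBracket I W X x) (Y x))

theorem koszul_tensorial_left {Y W : Π x : M, TangentSpace I x} {x : M}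
    (hY : MDiffAt (T% Y) x) (hW : MDiffAt (T% W) x) :
    TensorialAt I E (fun X ↦ koszul X Y W x) x where
  smul {f X} hf hX := by
    have h1 : MDiffAt (fun y ↦ inner ℝ (W y) (X y)) x := mdifferentiableAt_inner hW hX
    have h2 : MDiffAt (fun y ↦ inner ℝ (X y) (Y y)) x := mdifferentiableAt_inner hX hY
    simp only [koszul, Pi.smul_apply', real_inner_smul_left, real_inner_smul_right,
      mvfderiv_fun_mul hf h1, mvfderiv_fun_mul hf h2, mlieBracket_smul_left hf hX,
      mlieBracket_smul_right hf hX, inner_add_left]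
    simp [real_inner_comm]
    ring
  add {X X'} hX hX' := by
    have h1 : MDiffAt (fun y ↦ inner ℝ (W y) (X y)) x := mdifferentiableAt_inner hW hX
    have h2 : MDiffAt (fun y ↦ inner ℝ (X y) (Y y)) x := mdifferentiableAt_inner hX hY
    have h1' : MDiffAt (fun y ↦ inner ℝ (W y) (X' y)) x := mdifferentiableAt_inner hW hX'
    have h2' : MDiffAt (fun y ↦ inner ℝ (X' y) (Y y)) x := mdifferentiableAt_inner hX' hY
    simp only [koszul, Pi.add_apply, inner_add_left, inner_add_right,
      mvfderiv_fun_add h1 h1', mvfderiv_fun_add h2 h2', mlieBracket_add_left hX hX',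
      mlieBracket_add_right hX hX']
    simp
    ring

theorem koszul_tensorial_right {X Y : Π x : M, TangentSpace I x} {x : M}
    (hX : MDiffAt (T% X) x) (hY : MDiffAt (T% Y) x) :
    TensorialAt I E (fun W ↦ koszul X Y W x) x where
  smul {f W} hf hW := by
    have h1 : MDiffAt (fun y ↦ inner ℝ (W y) (X y)) x := mdifferentiableAt_inner hW hX
    have h2 : MDiffAt (fun y ↦ inner ℝ (Y y) (W y)) x := mdifferentiableAt_inner hY hW
    simp only [koszul, Pi.smul_apply', real_inner_smul_left, real_inner_smul_right,
      mvfderiv_fun_mul hf h1, mvfderiv_fun_mul hf h2, mlieBracket_smul_left hf hW,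
      mlieBracket_smul_right hf hW, inner_add_left]
    simp [real_inner_comm]
    ring
  add {W W'} hW hW' := by
    have h1 : MDiffAt (fun y ↦ inner ℝ (W y) (X y)) x := mdifferentiableAt_inner hW hX
    have h2 : MDiffAt (fun y ↦ inner ℝ (Y y) (W y)) x := mdifferentiableAt_inner hY hW
    have h1' : MDiffAt (fun y ↦ inner ℝ (W' y) (X y)) x := mdifferentiableAt_inner hW' hX
    have h2' : MDiffAt (fun y ↦ inner ℝ (Y y) (W' y)) x := mdifferentiableAt_inner hY hW'
    simp only [koszul, Pi.add_apply, inner_add_left, inner_add_right,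
      mvfderiv_fun_add h1 h1', mvfderiv_fun_add h2 h2', mlieBracket_add_left hW hW',
      mlieBracket_add_right hW hW']
    simp
    ring

theorem koszul_add {X Y Y' W : Π x : M, TangentSpace I x} {x : M} (hX : MDiffAt (T% X) x)
    (hY : MDiffAt (T% Y) x) (hY' : MDiffAt (T% Y') x) (hW : MDiffAt (T% W) x) :
    koszul X (Y + Y') W x = koszul X Y W x + koszul X Y' W x := by
  have h1 : MDiffAt (fun y ↦ inner ℝ (X y) (Y y)) x := mdifferentiableAt_inner hX hY
  have h2 : MDiffAt (fun y ↦ inner ℝ (Y y) (W y)) x := mdifferentiableAt_inner hY hW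
  have h1' : MDiffAt (fun y ↦ inner ℝ (X y) (Y' y)) x := mdifferentiableAt_inner hX hY'
  have h2' : MDiffAt (fun y ↦ inner ℝ (Y' y) (W y)) x := mdifferentiableAt_inner hY' hW
  simp only [koszul, Pi.add_apply, inner_add_left, inner_add_right,
    mvfderiv_fun_add h1 h1', mvfderiv_fun_add h2 h2', mlieBracket_add_left hY hY',
    mlieBracket_add_right hY hY']
  simp
  ring

theorem koszul_leibniz {X Y W : Π x : M, TangentSpace I x} {f : M → ℝ} {x : M}
    (hX : MDiffAt (T% X) x) (hf : MDiffAt f x) (hY : MDiffAt (T% Y) x) (hW : MDiffAt (T% W) x) :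
    koszul X (f • Y) W x
      = f x * koszul X Y W x + mvfderiv I f x (X x) * inner ℝ (Y x) (W x) := by
  have h1 : MDiffAt (fun y ↦ inner ℝ (X y) (Y y)) x := mdifferentiableAt_inner hX hY
  have h2 : MDiffAt (fun y ↦ inner ℝ (Y y) (W y)) x := mdifferentiableAt_inner hY hW
  simp only [koszul, Pi.smul_apply', real_inner_smul_left, real_inner_smul_right,
    mvfderiv_fun_mul hf h1, mvfderiv_fun_mul hf h2, mlieBracket_smul_left hf hY,
    mlieBracket_smul_right hf hY, inner_add_left]
  simp [real_inner_comm]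
  ring

open scoped Classical in
/-- The Koszul expression as a bilinear form in the values of `X` and `W` at `x`. -/
def koszulForm (Y : Π x : M, TangentSpace I x) (x : M) :
    TangentSpace I x →L[ℝ] TangentSpace I x →L[ℝ] ℝ :=
  if hY : MDiffAt (T% Y) x then
    TensorialAt.mkHom₂ (fun X W ↦ koszul X Y W x) x
      (fun _ hW ↦ koszul_tensorial_left hY hW) (fun _ hX ↦ koszul_tensorial_right hX hY)
  else 0

theorem koszulForm_apply {X Y W : Π x : M, TangentSpace I x} {x : M} (hX : MDiffAt (T% X) x)
    (hY : MDiffAt (T% Y) x) (hW : MDiffAt (T% W) x) :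
    koszulForm Y x (X x) (W x) = koszul X Y W x := by
  rw [koszulForm, dif_pos hY]
  exact TensorialAt.mkHom₂_apply _ _ hX hW

/-- `∇ Y` at `x`, as the endomorphism `u ↦ ∇_u Y` of the tangent space. -/
def leviCivitaFun (Y : Π x : M, TangentSpace I x) (x : M) :
    TangentSpace I x →L[ℝ] TangentSpace I x :=
  LinearMap.toContinuousLinearMap
    { toFun := fun u ↦ (InnerProductSpace.toDual ℝ (TangentSpace I x)).symm (koszulForm Y x u)
      map_add' := fun u v ↦ by simp
      map_smul' := fun c u ↦ by simp }

theorem inner_leviCivitaFun {X Y W : Π x : M, TangentSpace I x} {x : M} (hX : MDiffAt (T% X) x)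
    (hY : MDiffAt (T% Y) x) (hW : MDiffAt (T% W) x) :
    inner ℝ (leviCivitaFun Y x (X x)) (W x) = koszul X Y W x := by
  rw [← koszulForm_apply hX hY hW]
  simp [leviCivitaFun]

/-- The Levi-Civita connection of the Riemannian metric, defined by the Koszul formula.
As in Mathlib, `leviCivita Y x u` is `∇_u Y`. -/
def leviCivita : CovariantDerivative I E (fun x : M ↦ TangentSpace I x) where
  toFun := leviCivitaFun
  isCovariantDerivativeOnUniv := by
    constructor
    · intro Y Y' x hY hY' _
      ext1 u
      refine ext_inner_right ℝ fun w ↦ ?_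
      have hu := mdifferentiableAt_extend I E u
      have hw := mdifferentiableAt_extend I E w
      have h := koszul_add hu hY hY' hw
      rw [← inner_leviCivitaFun hu (mdifferentiableAt_add_section hY hY') hw,
        ← inner_leviCivitaFun hu hY hw, ← inner_leviCivitaFun hu hY' hw] at h
      simpa [inner_add_left] using h
    · intro Y f x hY hf _
      ext1 u
      refine ext_inner_right ℝ fun w ↦ ?_
      have hu := mdifferentiableAt_extend I E u
      have hw := mdifferentiableAt_extend I E w
      have h := koszul_leibniz hu hf hY hw
      rw [← inner_leviCivitaFun hu (hf.smul_section hY) hw,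
        ← inner_leviCivitaFun hu hY hw] at h
      simpa [inner_add_left, inner_smul_left] using h

theorem leviCivita_torsion :
    (leviCivita : CovariantDerivative I E (fun x : M ↦ TangentSpace I x)).torsion = 0 := by
  rw [CovariantDerivative.torsion_eq_zero_iff]
  intro X Y x hX hY
  refine ext_inner_right ℝ fun w ↦ ?_
  have hw := mdifferentiableAt_extend I E w
  have h1 := inner_leviCivitaFun hX hY hw
  have h2 := inner_leviCivitaFun hY hX hw
  rw [extend_apply_self] at h1 h2
  rw [inner_sub_left]
  change inner ℝ (leviCivitaFun Y x (X x)) w - inner ℝ (leviCivitaFun X x (Y x)) w = _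
  rw [h1, h2]
  simp only [koszul, extend_apply_self]
  rw [mlieBracket_swap_apply (V := Y) (W := X), mlieBracket_swap_apply (V := extend E w) (W := X),
    mlieBracket_swap_apply (V := extend E w) (W := Y)]
  simp only [real_inner_comm, inner_neg_left]
  ring

theorem leviCivita_isMetricCompatible :
    CovariantDerivative.IsMetricCompatible (F := E) (V := fun x : M ↦ TangentSpace I x)
      leviCivita := by
  rw [CovariantDerivative.isMetricCompatible_iff]
  intro x X Y W hX hY hW
  have h1 := inner_leviCivitaFun hX hY hW
  have h2 := inner_leviCivitaFun hX hW hY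
  rw [real_inner_comm] at h2
  change _ = inner ℝ (leviCivitaFun Y x (X x)) (W x) + inner ℝ (Y x) (leviCivitaFun W x (X x))
  rw [h1, h2]
  simp only [koszul]
  rw [mlieBracket_swap_apply (V := W) (W := Y), mlieBracket_swap_apply (V := W) (W := X),
    mlieBracket_swap_apply (V := Y) (W := X)]
  simp only [real_inner_comm, inner_neg_left]
  ring

/-- The curvature `R(X,Y)W = ∇_X ∇_Y W - ∇_Y ∇_X W - ∇_[X,Y] W` of vector fields. -/
def curvature (X Y W : Π x : M, TangentSpace I x) (x : M) : TangentSpace I x :=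
  leviCivita (fun y ↦ leviCivita W y (Y y)) x (X x)
    - leviCivita (fun y ↦ leviCivita W y (X y)) x (Y x)
    - leviCivita W x (mlieBracket I X Y x)

/-- The curvature tensor at `x`, evaluated on tangent vectors by extending them to vector fields
that are smooth near `x` (the value does not depend on the extensions). -/
def curvatureAt (x : M) (u v w : TangentSpace I x) : TangentSpace I x :=
  curvature (extend E u) (extend E v) (extend E w) x

/-- The Ricci operator `Q u = ∑ i, R(u, e i) (e i)` for an orthonormal basis `e` of `T_x M`,
so that `g(Q u, v) = tr (w ↦ R(w, u) v)`. -/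
def ricciOperator (x : M) (u : TangentSpace I x) : TangentSpace I x :=
  ∑ i, curvatureAt x u (stdOrthonormalBasis ℝ (TangentSpace I x) i)
    (stdOrthonormalBasis ℝ (TangentSpace I x) i)

/-- `(L_Z g)(X, Y)`. -/
def lieDerivMetric (Z X Y : Π x : M, TangentSpace I x) (x : M) : ℝ :=
  mvfderiv I (fun y ↦ inner ℝ (X y) (Y y)) x (Z x)
    - inner ℝ (mlieBracket I Z X x) (Y x) - inner ℝ (X x) (mlieBracket I Z Y x)

/-- A Killing vector field: a smooth vector field `Z` with `L_Z g = 0`, tested on all locally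
defined smooth vector fields. -/
structure IsKilling (Z : Π x : M, TangentSpace I x) : Prop where
  contMDiff : CMDiff ∞ (T% Z)
  lieDeriv_metric : ∀ (x : M) (X Y : Π x : M, TangentSpace I x),
    CMDiffAt ∞ (T% X) x → CMDiffAt ∞ (T% Y) x → lieDerivMetric Z X Y x = 0

end Riemannian

section Forms

variable {E : Type*} [NormedAddCommGroup E] [NormedSpace ℝ E]
  {H : Type*} [TopologicalSpace H] {I : ModelWithCorners ℝ E H}
  {M : Type*} [TopologicalSpace M] [ChartedSpace H M]

/-- `(dη)(X, Y) = X(η(Y)) - Y(η(X)) - η([X, Y])`. -/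
def dOneForm (η : Π x : M, TangentSpace I x →L[ℝ] ℝ) (X Y : Π x : M, TangentSpace I x)
    (x : M) : ℝ :=
  mvfderiv I (fun y ↦ η y (Y y)) x (X x) - mvfderiv I (fun y ↦ η y (X y)) x (Y x)
    - η x (mlieBracket I X Y x)

/-- `(η ∧ (dη)^n)(X₀, …, X₂ₙ)`. -/
def contactVolume {n : ℕ} (η : Π x : M, TangentSpace I x →L[ℝ] ℝ)
    (X : Fin (2 * n + 1) → Π x : M, TangentSpace I x) (x : M) : ℝ :=
  (1 / 2 ^ n) * ∑ σ : Equiv.Perm (Fin (2 * n + 1)), ((Equiv.Perm.sign σ : ℤ) : ℝ) *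
    (η x (X (σ 0) x) * ∏ i : Fin n,
      dOneForm η (X (σ ⟨2 * i + 1, by omega⟩)) (X (σ ⟨2 * i + 2, by omega⟩)) x)

/-- `(L_Z η)(X) = Z(η(X)) - η([Z, X])`. -/
def lieDerivOneForm (Z : Π x : M, TangentSpace I x) (η : Π x : M, TangentSpace I x →L[ℝ] ℝ)
    (X : Π x : M, TangentSpace I x) (x : M) : ℝ :=
  mvfderiv I (fun y ↦ η y (X y)) x (Z x) - η x (mlieBracket I Z X x)

/-- `(L_Z φ)(X) = [Z, φ X] - φ [Z, X]`. -/
def lieDerivEndo (Z : Π x : M, TangentSpace I x)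
    (φ : Π x : M, TangentSpace I x →L[ℝ] TangentSpace I x)
    (X : Π x : M, TangentSpace I x) (x : M) : TangentSpace I x :=
  mlieBracket I Z (fun y ↦ φ y (X y)) x - φ x (mlieBracket I Z X x)

/-- A subset of a manifold has measure zero if its image in every chart is Lebesgue-null. -/
def IsNullSet {d : ℕ} {M : Type*} [TopologicalSpace M]
    [ChartedSpace (EuclideanSpace ℝ (Fin d)) M] (s : Set M) : Prop :=
  ∀ x : M, volume (chartAt (EuclideanSpace ℝ (Fin d)) x ''
    ((chartAt (EuclideanSpace ℝ (Fin d)) x).source ∩ s)) = 0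

end Forms

section Contact

variable {E : Type*} [NormedAddCommGroup E] [NormedSpace ℝ E] [FiniteDimensional ℝ E]
  {H : Type*} [TopologicalSpace H] {I : ModelWithCorners ℝ E H}
  {M : Type*} [TopologicalSpace M] [ChartedSpace H M] [IsManifold I ∞ M]

/-- `η` is a contact form: a smooth one-form such that `η ∧ (dη)^n` vanishes nowhere. -/
structure IsContactForm (n : ℕ) (η : Π x : M, TangentSpace I x →L[ℝ] ℝ) : Prop where
  contMDiff : ContMDiff I (I.prod 𝓘(ℝ, E →L[ℝ] ℝ)) ∞
    (fun x ↦ TotalSpace.mk' (E →L[ℝ] ℝ)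
      (E := fun x : M ↦ TangentSpace I x →L[ℝ] Bundle.Trivial M ℝ x) x (η x))
  volume_ne_zero : ∀ x : M, ∃ X : Fin (2 * n + 1) → Π x : M, TangentSpace I x,
    (∀ i, CMDiffAt ∞ (T% (X i)) x) ∧ contactVolume η X x ≠ 0

variable [RiemannianBundle (fun x : M ↦ TangentSpace I x)]

/-- `(η, ξ, φ, g)` is a contact metric structure on `M`, where `g` is the Riemannian metric
with which `M` is endowed: `η` is a contact form, `ξ` is a unit vector field, `η(ξ) = 1`,
`φ² = -Id + η ⊗ ξ`, `φ ξ = 0`, and `dη(X, Y) = 2 g(X, φ Y)`. -/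
structure IsContactMetricStructure (n : ℕ)
    (η : Π x : M, TangentSpace I x →L[ℝ] ℝ)
    (ξ : Π x : M, TangentSpace I x)
    (φ : Π x : M, TangentSpace I x →L[ℝ] TangentSpace I x) :
    Prop where
  isContactForm : IsContactForm n η
  contMDiff_reeb : CMDiff ∞ (T% ξ)
  contMDiff_endo : ContMDiff I (I.prod 𝓘(ℝ, E →L[ℝ] E)) ∞
    (fun x ↦ TotalSpace.mk' (E →L[ℝ] E)
      (E := fun x : M ↦ TangentSpace I x →L[ℝ] TangentSpace I x) x (φ x))
  norm_reeb : ∀ x, ‖ξ x‖ = 1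
  eta_reeb : ∀ x, η x (ξ x) = 1
  endo_sq : ∀ x u, φ x (φ x u) = -u + η x u • ξ x
  endo_reeb : ∀ x, φ x (ξ x) = 0
  d_eta : ∀ (x : M) (X Y : Π x : M, TangentSpace I x),
    CMDiffAt ∞ (T% X) x → CMDiffAt ∞ (T% Y) x →
      dOneForm η X Y x = 2 * inner ℝ (X x) (φ x (Y x))

variable [IsContMDiffRiemannianBundle I ∞ E (fun x : M ↦ TangentSpace I x)]

/-- The contact metric structure is generalized Eta-Einstein with coefficients `lam`, `gam`:
these are smooth functions and the Ricci operator is `Q = lam Id + gam η ⊗ ξ`. -/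
structure IsGeneralizedEtaEinstein
    (η : Π x : M, TangentSpace I x →L[ℝ] ℝ)
    (ξ : Π x : M, TangentSpace I x) (lam gam : M → ℝ) : Prop where
  contMDiff_lam : CMDiff ∞ lam
  contMDiff_gam : CMDiff ∞ gam
  ricci : ∀ (x : M) (u : TangentSpace I x),
    ricciOperator x u = lam x • u + (gam x * η x u) • ξ x

/-- `Z` is an infinitesimal automorphism of the contact metric structure `(η, ξ, φ, g)`: all four
tensor fields have vanishing Lie derivative in the direction of `Z`. -/
structure IsInfinitesimalAutomorphism
    (η : Π x : M, TangentSpace I x →L[ℝ] ℝ)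
    (ξ : Π x : M, TangentSpace I x)
    (φ : Π x : M, TangentSpace I x →L[ℝ] TangentSpace I x)
    (Z : Π x : M, TangentSpace I x) : Prop where
  contMDiff : CMDiff ∞ (T% Z)
  lieDeriv_eta : ∀ (x : M) (X : Π x : M, TangentSpace I x),
    CMDiffAt ∞ (T% X) x → lieDerivOneForm Z η X x = 0
  lieDeriv_reeb : ∀ x : M, mlieBracket I Z ξ x = 0
  lieDeriv_endo : ∀ (x : M) (X : Π x : M, TangentSpace I x),
    CMDiffAt ∞ (T% X) x → lieDerivEndo Z φ X x = 0
  lieDeriv_metric : ∀ (x : M) (X Y : Π x : M, TangentSpace I x),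
    CMDiffAt ∞ (T% X) x → CMDiffAt ∞ (T% Y) x → lieDerivMetric Z X Y x = 0

end Contact

end ContactMetric

end

/-! A Killing field preserves everything built from the metric, in particular the Ricci operator, so
$L_Z Q=0$. Applying $L_Z$ to $Q=\lambda\,\mathrm{Id}+\gamma\,\eta\otimes\xi$, where
$\eta=g(\xi,\cdot)$, gives for every $v$
$$(Z\lambda)v+\bigl((Z\gamma)\,\eta(v)+\gamma\,g([Z,\xi],v)\bigr)\xi+\gamma\,\eta(v)[Z,\xi]=0.$$
Since $\xi$ has unit length, $[Z,\xi]\perp\xi$. Taking $v=\xi$ therefore yields $Z\lambda+Z\gamma=0$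
from the $\xi$-component and $\gamma[Z,\xi]=0$ from the rest; a nonzero $v\perp\xi$ yields
$Z\lambda=0$. A null set has dense complement, so $[Z,\xi]=0$ everywhere by continuity. Then
$L_Z\eta=0$ because $\eta$ is the metric dual of $\xi$, hence $L_Z d\eta=0$, and
$d\eta=2g(\cdot,\phi\,\cdot)$ with $g$ nondegenerate forces $L_Z\phi=0$.

The invariance of $Q$ is proved infinitesimally, without flows.
`IsKilling.lieDerivLeviCivita_eq_zero` shows $L_Z\nabla=0$, `IsKilling.mlieBracket_curvature`
deduces $L_ZR=0$, and `IsKilling.mlieBracket_ricciOperator` takes the trace in a local orthonormal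
frame. The contact part rests on `lieDeriv_ricciOperator`.

Fields are taken smooth on a neighbourhood of the point: this class is closed under brackets and
covariant derivatives, and identities valid near the point can be differentiated again. -/

noncomputable section

namespace ContactMetric

open Filter Topology

set_option linter.unusedSectionVars false

/-! ### Calculus of locally smooth fields and functions, and of the Lie bracket. -/

section SmoothNear

variable {E : Type*} [NormedAddCommGroup E] [NormedSpace ℝ E]
  {H : Type*} [TopologicalSpace H] {I : ModelWithCorners ℝ E H}
  {M : Type*} [TopologicalSpace M] [ChartedSpace H M] [IsManifold I ∞ M]

/-- The vector field `X` is smooth on a neighbourhood of `x`. -/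
def SmoothNear (X : Π x : M, TangentSpace I x) (x : M) : Prop :=
  ∀ᶠ y in 𝓝 x, CMDiffAt ∞ (T% X) y

variable (I) in
/-- The function `f` is smooth on a neighbourhood of `x`. -/
def SmoothFunNear (f : M → ℝ) (x : M) : Prop :=
  ∀ᶠ y in 𝓝 x, CMDiffAt ∞ f y

variable {X Y W : Π x : M, TangentSpace I x} {f g : M → ℝ} {x : M}

theorem SmoothNear.eventually (h : SmoothNear X x) : ∀ᶠ y in 𝓝 x, SmoothNear X y :=
  eventually_eventually_nhds.2 h

theorem SmoothFunNear.eventually (h : SmoothFunNear I f x) : ∀ᶠ y in 𝓝 x, SmoothFunNear I f y :=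
  eventually_eventually_nhds.2 h

theorem SmoothNear.contMDiffAt (h : SmoothNear X x) : CMDiffAt ∞ (T% X) x := h.self_of_nhds

theorem SmoothFunNear.contMDiffAt (h : SmoothFunNear I f x) : CMDiffAt ∞ f x := h.self_of_nhds

theorem SmoothNear.mdiff (h : SmoothNear X x) : MDiffAt (T% X) x :=
  h.contMDiffAt.mdifferentiableAt (by simp)

theorem SmoothFunNear.mdiff (h : SmoothFunNear I f x) : MDiffAt f x :=
  h.contMDiffAt.mdifferentiableAt (by simp)

theorem SmoothNear.congr (h : SmoothNear X x) (hXY : X =ᶠ[𝓝 x] Y) : SmoothNear Y x := by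
  filter_upwards [h, hXY.eventuallyEq_nhds] with y hy hy'
  exact hy.congr_of_eventuallyEq (hy'.mono fun z hz ↦ by simp [hz])

theorem SmoothFunNear.congr (h : SmoothFunNear I f x) (hfg : f =ᶠ[𝓝 x] g) :
    SmoothFunNear I g x := by
  filter_upwards [h, hfg.eventuallyEq_nhds] with y hy hy'
  exact hy.congr_of_eventuallyEq hy'.symm

theorem SmoothFunNear.add (hf : SmoothFunNear I f x) (hg : SmoothFunNear I g x) :
    SmoothFunNear I (fun y ↦ f y + g y) x := by
  filter_upwards [hf, hg] with y h1 h2 using h1.add h2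

theorem SmoothFunNear.sub (hf : SmoothFunNear I f x) (hg : SmoothFunNear I g x) :
    SmoothFunNear I (fun y ↦ f y - g y) x := by
  filter_upwards [hf, hg] with y h1 h2 using h1.sub h2

theorem SmoothFunNear.mul (hf : SmoothFunNear I f x) (hg : SmoothFunNear I g x) :
    SmoothFunNear I (fun y ↦ f y * g y) x := by
  filter_upwards [hf, hg] with y h1 h2 using h1.mul h2

theorem SmoothFunNear.const (c : ℝ) : SmoothFunNear I (fun _ : M ↦ c) x :=
  Eventually.of_forall fun _ ↦ contMDiffAt_const

theorem SmoothFunNear.comp {F : ℝ → ℝ}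
    (hF : ∀ᶠ t in 𝓝 (f x), ContDiffAt ℝ ∞ F t) (hf : SmoothFunNear I f x) :
    SmoothFunNear I (fun y ↦ F (f y)) x := by
  filter_upwards [hf, hf.contMDiffAt.continuousAt.eventually hF] with y h1 h2
  exact h2.contMDiffAt.comp y h1

theorem SmoothNear.add (hX : SmoothNear X x) (hY : SmoothNear Y x) :
    SmoothNear (fun y ↦ X y + Y y) x := by
  filter_upwards [hX, hY] with y h1 h2 using ContMDiffAt.add_section h1 h2

theorem SmoothNear.sub (hX : SmoothNear X x) (hY : SmoothNear Y x) :
    SmoothNear (fun y ↦ X y - Y y) x := by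
  filter_upwards [hX, hY] with y h1 h2 using ContMDiffAt.sub_section h1 h2

theorem SmoothNear.smul (hf : SmoothFunNear I f x) (hX : SmoothNear X x) :
    SmoothNear (fun y ↦ f y • X y) x := by
  filter_upwards [hf, hX] with y h1 h2 using ContMDiffAt.smul_section h1 h2

theorem SmoothNear.sum {ι : Type*} {s : Finset ι} {X : ι → Π x : M, TangentSpace I x}
    (hX : ∀ i ∈ s, SmoothNear (X i) x) : SmoothNear (fun y ↦ ∑ i ∈ s, X i y) x := by
  have : ∀ᶠ y in 𝓝 x, ∀ i ∈ s, CMDiffAt ∞ (T% (X i)) y := (Finset.eventually_all s).2 hX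
  filter_upwards [this] with y h using ContMDiffAt.sum_section h

variable [FiniteDimensional ℝ E]

theorem smoothNear_extend (u : TangentSpace I x) : SmoothNear (extend E u) x := by
  obtain ⟨s, hs, h⟩ := exists_contMDiffOn_extend (k := ∞) I E u
  filter_upwards [eventually_mem_nhds_iff.2 hs] with y hy
  exact (h y (mem_of_mem_nhds hy)).contMDiffAt hy

theorem SmoothNear.mlieBracket (hX : SmoothNear X x) (hY : SmoothNear Y x) :
    SmoothNear (mlieBracket I X Y) x := by
  filter_upwards [hX, hY] with y h1 h2
  have : IsManifold I (minSmoothness ℝ 2) M :=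
    .of_le (n := ∞) (by simp; exact WithTop.coe_le_coe.2 le_top)
  have : IsManifold I ((⊤ : ℕ∞) + 1) M := inferInstanceAs (IsManifold I ∞ M)
  exact ContMDiffAt.mlieBracket_vectorField (m := ⊤) (n := ⊤) h1 h2
    (by rw [minSmoothness_of_isRCLikeNormedField]; exact le_rfl)

theorem mlieBracket_fun_smul_right (hf : MDiffAt f x) (hY : MDiffAt (T% Y) x) :
    VectorField.mlieBracket I X (fun y ↦ f y • Y y) x
      = mvfderiv I f x (X x) • Y x + f x • VectorField.mlieBracket I X Y x :=
  mlieBracket_smul_right hf hY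

theorem mlieBracket_fun_smul_left (hf : MDiffAt f x) (hX : MDiffAt (T% X) x) :
    VectorField.mlieBracket I (fun y ↦ f y • X y) Y x
      = - mvfderiv I f x (Y x) • X x + f x • VectorField.mlieBracket I X Y x :=
  mlieBracket_smul_left hf hX

theorem mlieBracket_fun_add_right (hX : MDiffAt (T% X) x) (hY : MDiffAt (T% Y) x) :
    VectorField.mlieBracket I W (fun y ↦ X y + Y y) x
      = VectorField.mlieBracket I W X x + VectorField.mlieBracket I W Y x :=
  mlieBracket_add_right hX hY

theorem mlieBracket_fun_add_left (hX : MDiffAt (T% X) x) (hY : MDiffAt (T% Y) x) :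
    VectorField.mlieBracket I (fun y ↦ X y + Y y) W x
      = VectorField.mlieBracket I X W x + VectorField.mlieBracket I Y W x :=
  mlieBracket_add_left hX hY

theorem mlieBracket_fun_sub_right (hX : MDiffAt (T% X) x) (hY : MDiffAt (T% Y) x) :
    VectorField.mlieBracket I W (fun y ↦ X y - Y y) x
      = VectorField.mlieBracket I W X x - VectorField.mlieBracket I W Y x := by
  have h := mlieBracket_fun_add_right (W := W) (mdifferentiableAt_sub_section hX hY) hY
  have h2 : (fun y ↦ (X - Y) y + Y y) = X := by ext y; simp
  rw [h2] at h
  rw [h]; simp; rfl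

theorem mlieBracket_fun_sum_right {ι : Type*} {s : Finset ι} {X : ι → Π x : M, TangentSpace I x}
    (hX : ∀ i ∈ s, MDiffAt (T% (X i)) x) :
    VectorField.mlieBracket I W (fun y ↦ ∑ i ∈ s, X i y) x
      = ∑ i ∈ s, VectorField.mlieBracket I W (X i) x := by
  classical
  induction s using Finset.induction_on with
  | empty => exact congrFun (mlieBracket_zero_right (I := I) (W := W)) x
  | insert a s ha ih =>
    simp only [Finset.sum_insert ha]
    rw [mlieBracket_fun_add_right (hX a (by simp))
      (.sum_section fun i hi ↦ hX i (Finset.mem_insert_of_mem hi)),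
      ih fun i hi ↦ hX i (Finset.mem_insert_of_mem hi)]

theorem mlieBracket_congr_right (h : X =ᶠ[𝓝 x] Y) :
    VectorField.mlieBracket I W X x = VectorField.mlieBracket I W Y x :=
  EventuallyEq.mlieBracket_vectorField_eq EventuallyEq.rfl h

theorem mvfderiv_congr (h : f =ᶠ[𝓝 x] g) : mvfderiv I f x = mvfderiv I g x := by
  ext u
  exact congrArg (fun L : TangentSpace I x →L[ℝ] ℝ ↦ L u) h.mfderiv_eq

theorem mlieBracket_jacobi (hX : SmoothNear X x) (hY : SmoothNear Y x) (hW : SmoothNear W x) :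
    VectorField.mlieBracket I X (VectorField.mlieBracket I Y W) x =
      VectorField.mlieBracket I (VectorField.mlieBracket I X Y) W x
        + VectorField.mlieBracket I Y (VectorField.mlieBracket I X W) x := by
  have : IsManifold I (minSmoothness ℝ 3) M :=
    .of_le (n := ∞) (by simp; exact WithTop.coe_le_coe.2 le_top)
  have h2 : minSmoothness ℝ 2 ≤ ∞ := by simp; exact WithTop.coe_le_coe.2 le_top
  exact leibniz_identity_mlieBracket_apply (hX.contMDiffAt.of_le h2) (hY.contMDiffAt.of_le h2)
    (hW.contMDiffAt.of_le h2)

end SmoothNear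

/-! ### Local orthonormal frames, and derivatives of functions along fields. -/

section Frames

variable {E : Type*} [NormedAddCommGroup E] [NormedSpace ℝ E] [FiniteDimensional ℝ E]
  {H : Type*} [TopologicalSpace H] {I : ModelWithCorners ℝ E H}
  {M : Type*} [TopologicalSpace M] [ChartedSpace H M] [IsManifold I ∞ M]
  [RiemannianBundle (fun x : M ↦ TangentSpace I x)]
  [IsContMDiffRiemannianBundle I ∞ E (fun x : M ↦ TangentSpace I x)]
  {X Y W : Π x : M, TangentSpace I x} {f : M → ℝ} {x : M}

theorem SmoothNear.inner (hX : SmoothNear X x) (hY : SmoothNear Y x) :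
    SmoothFunNear I (fun y ↦ inner ℝ (X y) (Y y)) x := by
  filter_upwards [hX, hY] with y h1 h2
  exact ContMDiffAt.inner_bundle (F := E) (E := fun x : M ↦ TangentSpace I x) (b := id) h1 h2

/-- The vector fields `e i` form a smooth orthonormal frame on a neighbourhood of `x`. -/
structure IsOrthonormalFrameNear (e : Fin (finrank ℝ E) → Π x : M, TangentSpace I x) (x : M) :
    Prop where
  smooth : ∀ i, SmoothNear (e i) x
  orthonormal : ∀ᶠ y in 𝓝 x, Orthonormal ℝ (fun i ↦ e i y)

/-- Strong induction on the index: each vector is the original one minus projections on earlier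
ones. The denominators are squared lengths of earlier Gram–Schmidt vectors, nonzero by linear
independence. -/
theorem smoothNear_gramSchmidt {s : Fin (finrank ℝ E) → Π x : M, TangentSpace I x}
    (hs : ∀ i, SmoothNear (s i) x)
    (hli : ∀ᶠ y in 𝓝 x, LinearIndependent ℝ (fun i ↦ s i y)) (i : Fin (finrank ℝ E)) :
    SmoothNear (fun y ↦ InnerProductSpace.gramSchmidt ℝ (fun i ↦ s i y) i) x := by
  induction i using WellFoundedLT.induction with
  | ind i ih =>
    refine ((hs i).sub (SmoothNear.sum (s := Finset.Iio i) (X := fun j y ↦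
      (inner ℝ (InnerProductSpace.gramSchmidt ℝ (fun i ↦ s i y) j) (s i y) *
        (inner ℝ (InnerProductSpace.gramSchmidt ℝ (fun i ↦ s i y) j)
          (InnerProductSpace.gramSchmidt ℝ (fun i ↦ s i y) j))⁻¹) •
        InnerProductSpace.gramSchmidt ℝ (fun i ↦ s i y) j) fun j hj ↦ ?_)).congr
      (Eventually.of_forall fun y ↦ ?_)
    · have h := ih j (Finset.mem_Iio.1 hj)
      refine SmoothNear.smul ((h.inner (hs i)).mul
        (SmoothFunNear.comp (F := fun t ↦ t⁻¹) ?_ (h.inner h))) h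
      have h0 : inner ℝ (InnerProductSpace.gramSchmidt ℝ (fun i ↦ s i x) j)
          (InnerProductSpace.gramSchmidt ℝ (fun i ↦ s i x) j) ≠ (0 : ℝ) :=
        inner_self_ne_zero.2 (InnerProductSpace.gramSchmidt_ne_zero j hli.self_of_nhds)
      filter_upwards [isOpen_ne.mem_nhds h0] with t ht
      exact contDiffAt_inv ℝ ht
    · simp only
      rw [InnerProductSpace.gramSchmidt_def ℝ _ i]
      simp only [Submodule.starProjection_singleton, real_inner_self_eq_norm_sq, div_eq_mul_inv]
      rfl

theorem exists_isOrthonormalFrameNear (x : M) :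
    ∃ e : Fin (finrank ℝ E) → Π x : M, TangentSpace I x, IsOrthonormalFrameNear e x := by
  let t := trivializationAt E (fun x : M ↦ TangentSpace I x) x
  have hx : x ∈ t.baseSet := FiberBundle.mem_baseSet_trivializationAt' x
  have hF := t.isLocalFrameOn_localFrame_baseSet I ∞ (finBasis ℝ E)
  have ht : ∀ᶠ y in 𝓝 x, y ∈ t.baseSet := t.open_baseSet.mem_nhds hx
  let s := t.localFrame (finBasis ℝ E)
  have hs (i) : SmoothNear (s i) x := ht.mono fun y hy ↦ hF.contMDiffAt t.open_baseSet hy i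
  have hli : ∀ᶠ y in 𝓝 x, LinearIndependent ℝ (fun i ↦ s i y) :=
    ht.mono fun y hy ↦ hF.linearIndependent hy
  refine ⟨fun i y ↦ InnerProductSpace.gramSchmidtNormed ℝ (fun i ↦ s i y) i, fun i ↦ ?_,
    hli.mono fun y hy ↦ InnerProductSpace.gramSchmidtNormed_orthonormal hy⟩
  have h := smoothNear_gramSchmidt hs hli i
  have h0 : inner ℝ (InnerProductSpace.gramSchmidt ℝ (fun i ↦ s i x) i)
      (InnerProductSpace.gramSchmidt ℝ (fun i ↦ s i x) i) ≠ (0 : ℝ) :=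
    inner_self_ne_zero.2 (InnerProductSpace.gramSchmidt_ne_zero i hli.self_of_nhds)
  -- The norm is written as the square root of the squared length, so that the normalising factor is
  -- a smooth function of a positive smooth function.
  refine (SmoothNear.smul (SmoothFunNear.comp (F := fun t ↦ (√t)⁻¹) ?_ (h.inner h)) h).congr
    (Eventually.of_forall fun y ↦ ?_)
  · filter_upwards [isOpen_ne.mem_nhds h0, lt_mem_nhds (lt_of_le_of_ne real_inner_self_nonneg
      h0.symm)] with t ht ht'
    exact (Real.contDiffAt_sqrt ht).inv (Real.sqrt_ne_zero'.2 ht')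
  · simp only [InnerProductSpace.gramSchmidtNormed, real_inner_self_eq_norm_sq,
      Real.sqrt_sq (norm_nonneg _)]
    rfl

namespace IsOrthonormalFrameNear

variable {e : Fin (finrank ℝ E) → Π x : M, TangentSpace I x}

theorem eventually (he : IsOrthonormalFrameNear e x) :
    ∀ᶠ y in 𝓝 x, IsOrthonormalFrameNear e y := by
  filter_upwards [eventually_all.2 fun i ↦ (he.smooth i).eventually,
    eventually_eventually_nhds.2 he.orthonormal] with y h1 h2 using ⟨h1, h2⟩

theorem exists_orthonormalBasis (he : IsOrthonormalFrameNear e x) :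
    ∃ b : OrthonormalBasis (Fin (finrank ℝ E)) ℝ (TangentSpace I x), ∀ i, b i = e i x := by
  have h := he.orthonormal.self_of_nhds
  have hcard : finrank ℝ (TangentSpace I x) = Fintype.card (Fin (finrank ℝ E)) := by
    rw [Fintype.card_fin]; rfl
  obtain ⟨b, hb⟩ := Orthonormal.exists_orthonormalBasis_extension_of_card_eq hcard
    (v := fun i ↦ e i x) (s := Set.univ) (h.comp _ Subtype.coe_injective)
  exact ⟨b, fun i ↦ hb i trivial⟩

theorem inner_eq (he : IsOrthonormalFrameNear e x) (i j) :
    inner ℝ (e i x) (e j x) = if i = j then (1 : ℝ) else 0 :=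
  orthonormal_iff_ite.1 he.orthonormal.self_of_nhds i j

theorem sum_inner_smul (he : IsOrthonormalFrameNear e x) (u : TangentSpace I x) :
    ∑ i, inner ℝ (e i x) u • e i x = u := by
  obtain ⟨b, hb⟩ := he.exists_orthonormalBasis
  simpa [hb] using b.sum_repr' u

theorem eventuallyEq_sum (he : IsOrthonormalFrameNear e x) (X : Π x : M, TangentSpace I x) :
    (fun y ↦ ∑ i, inner ℝ (e i y) (X y) • e i y) =ᶠ[𝓝 x] X :=
  he.eventually.mono fun _ hy ↦ hy.sum_inner_smul _

end IsOrthonormalFrameNear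

/-- A local unit field $W$ lets a function $f$ be recovered from the field $fW$, so that facts about
functions follow from facts about brackets. -/
theorem exists_norm_eq_one [Nontrivial E] (x : M) :
    ∃ W : Π x : M, TangentSpace I x, SmoothNear W x ∧
      ∀ᶠ y in 𝓝 x, inner ℝ (W y) (W y) = (1 : ℝ) := by
  obtain ⟨e, he⟩ := exists_isOrthonormalFrameNear (I := I) x
  let i : Fin (finrank ℝ E) := ⟨0, finrank_pos⟩
  exact ⟨e i, he.smooth i, he.eventually.mono fun y hy ↦ by rw [hy.inner_eq, if_pos rfl]⟩

variable [Nontrivial E]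

/-- For a unit field $W$, $[X,fW]-f[X,W]=(Xf)W$; pairing with $W$ expresses $Xf$ through smooth
fields. -/
theorem SmoothFunNear.mvfderiv (hf : SmoothFunNear I f x) (hX : SmoothNear X x) :
    SmoothFunNear I (fun y ↦ mvfderiv I f y (X y)) x := by
  obtain ⟨W, hW, hW1⟩ := exists_norm_eq_one (I := I) x
  have h := ((hX.mlieBracket (SmoothNear.smul hf hW)).sub
    (SmoothNear.smul hf (hX.mlieBracket hW))).inner hW
  refine h.congr ?_
  filter_upwards [hf.eventually, hW.eventually, hW1] with y h1 h2 h3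
  rw [mlieBracket_fun_smul_right h1.mdiff h2.mdiff, add_sub_cancel_right, real_inner_smul_left, h3,
    mul_one]

/-- Expand the Jacobi identity for $X$, $Y$, $fW$ with $W$ a unit field. The terms in $[X,W]$ and
$[Y,W]$ cancel, those in $f$ cancel by Jacobi for $W$, and the coefficient of $W$ is the claim. -/
theorem mvfderiv_mlieBracket (hf : SmoothFunNear I f x) (hX : SmoothNear X x)
    (hY : SmoothNear Y x) :
    _root_.mvfderiv I f x (mlieBracket I X Y x)
      = _root_.mvfderiv I (fun y ↦ _root_.mvfderiv I f y (Y y)) x (X x)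
        - _root_.mvfderiv I (fun y ↦ _root_.mvfderiv I f y (X y)) x (Y x) := by
  obtain ⟨W, hW, hW1⟩ := exists_norm_eq_one (I := I) x
  have key (X Y : Π x : M, TangentSpace I x) (hX : SmoothNear X x) (hY : SmoothNear Y x) :
      mlieBracket I X (mlieBracket I Y fun y ↦ f y • W y) x =
        _root_.mvfderiv I (fun y ↦ _root_.mvfderiv I f y (Y y)) x (X x) • W x
        + _root_.mvfderiv I f x (Y x) • mlieBracket I X W x
        + _root_.mvfderiv I f x (X x) • mlieBracket I Y W x
        + f x • mlieBracket I X (mlieBracket I Y W) x := by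
    have h1 : mlieBracket I Y (fun y ↦ f y • W y) =ᶠ[𝓝 x]
        fun y ↦ _root_.mvfderiv I f y (Y y) • W y + f y • mlieBracket I Y W y := by
      filter_upwards [hf.eventually, hW.eventually] with y h1 h2
      exact mlieBracket_fun_smul_right h1.mdiff h2.mdiff
    rw [mlieBracket_congr_right h1, mlieBracket_fun_add_right
      (SmoothNear.smul (hf.mvfderiv hY) hW).mdiff (SmoothNear.smul hf (hY.mlieBracket hW)).mdiff,
      mlieBracket_fun_smul_right (hf.mvfderiv hY).mdiff hW.mdiff,
      mlieBracket_fun_smul_right hf.mdiff (hY.mlieBracket hW).mdiff]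
    abel
  have h := mlieBracket_jacobi hX hY (SmoothNear.smul hf hW)
  rw [key X Y hX hY, key Y X hY hX, mlieBracket_fun_smul_right hf.mdiff hW.mdiff,
    mlieBracket_jacobi hX hY hW] at h
  have h2 := congrArg (fun v ↦ inner ℝ v (W x)) h
  simp only [inner_add_left, real_inner_smul_left, hW1.self_of_nhds] at h2
  linarith

end Frames

/-! ### Killing fields preserve the Levi-Civita connection and its curvature. -/

section LeviCivita

variable {E : Type*} [NormedAddCommGroup E] [NormedSpace ℝ E] [FiniteDimensional ℝ E]
  {H : Type*} [TopologicalSpace H] {I : ModelWithCorners ℝ E H}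
  {M : Type*} [TopologicalSpace M] [ChartedSpace H M] [IsManifold I ∞ M]
  [RiemannianBundle (fun x : M ↦ TangentSpace I x)]
  [IsContMDiffRiemannianBundle I ∞ E (fun x : M ↦ TangentSpace I x)]
  {X Y W Z : Π x : M, TangentSpace I x} {f : M → ℝ} {x : M}

theorem inner_leviCivita (hX : MDiffAt (T% X) x) (hY : MDiffAt (T% Y) x) (hW : MDiffAt (T% W) x) :
    inner ℝ (leviCivita Y x (X x)) (W x) = koszul X Y W x :=
  inner_leviCivitaFun hX hY hW

theorem leviCivita_add (hX : MDiffAt (T% X) x) (hY : MDiffAt (T% Y) x) (u : TangentSpace I x) :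
    leviCivita (fun y ↦ X y + Y y) x u = leviCivita X x u + leviCivita Y x u :=
  congrArg (fun L ↦ L u) (leviCivita.isCovariantDerivativeOnUniv.add hX hY)

theorem leviCivita_smul (hf : MDiffAt f x) (hY : MDiffAt (T% Y) x) (u : TangentSpace I x) :
    leviCivita (fun y ↦ f y • Y y) x u = f x • leviCivita Y x u + mvfderiv I f x u • Y x :=
  congrArg (fun L ↦ L u) (leviCivita.isCovariantDerivativeOnUniv.leibniz hY hf)

theorem leviCivita_congr (hX : MDiffAt (T% X) x) (hY : MDiffAt (T% Y) x) (h : X =ᶠ[𝓝 x] Y) :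
    leviCivita X x = leviCivita Y x :=
  leviCivita.isCovariantDerivativeOnUniv.congr_of_eventuallyEq hX hY (by simp) h

theorem leviCivita_sub_leviCivita (hX : MDiffAt (T% X) x) (hY : MDiffAt (T% Y) x) :
    leviCivita Y x (X x) - leviCivita X x (Y x) = mlieBracket I X Y x :=
  leviCivita.torsion_eq_zero_iff.1 leviCivita_torsion hX hY

theorem mvfderiv_inner_eq_leviCivita (hX : MDiffAt (T% X) x) (hY : MDiffAt (T% Y) x)
    (hW : MDiffAt (T% W) x) :
    mvfderiv I (fun y ↦ inner ℝ (Y y) (W y)) x (X x)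
      = inner ℝ (leviCivita Y x (X x)) (W x) + inner ℝ (Y x) (leviCivita W x (X x)) := by
  have h := leviCivita_isMetricCompatible (I := I) (M := M)
  rw [CovariantDerivative.isMetricCompatible_iff] at h
  exact h hX hY hW

theorem SmoothFunNear.koszul [Nontrivial E] (hX : SmoothNear X x) (hY : SmoothNear Y x)
    (hW : SmoothNear W x) : SmoothFunNear I (koszul X Y W) x :=
  (SmoothFunNear.const (1 / 2)).mul
    (((((((hY.inner hW).mvfderiv hX).add ((hW.inner hX).mvfderiv hY)).sub
    ((hX.inner hY).mvfderiv hW)).add ((hX.mlieBracket hY).inner hW)).sub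
    ((hY.mlieBracket hW).inner hX)).add ((hW.mlieBracket hX).inner hY))

/-- The components in a smooth orthonormal frame are Koszul expressions, which are smooth. -/
theorem SmoothNear.leviCivita [Nontrivial E] (hX : SmoothNear X x) (hY : SmoothNear Y x) :
    SmoothNear (fun y ↦ leviCivita Y y (X y)) x := by
  obtain ⟨e, he⟩ := exists_isOrthonormalFrameNear (I := I) x
  refine (SmoothNear.sum (s := Finset.univ) (X := fun i y ↦ ContactMetric.koszul X Y (e i) y • e i y)
    fun i _ ↦ SmoothNear.smul (SmoothFunNear.koszul hX hY (he.smooth i)) (he.smooth i)).congr ?_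
  filter_upwards [hX.eventually, hY.eventually, he.eventually] with y h1 h2 h3
  conv_rhs => rw [← h3.sum_inner_smul (ContactMetric.leviCivita Y y (X y))]
  refine Finset.sum_congr rfl fun i _ ↦ ?_
  rw [real_inner_comm, inner_leviCivita h1.mdiff h2.mdiff (h3.smooth i).mdiff]

theorem IsKilling.smoothNear (hZ : IsKilling Z) : SmoothNear Z x :=
  Eventually.of_forall fun y ↦ hZ.contMDiff y

theorem IsKilling.mvfderiv_inner (hZ : IsKilling Z) (hX : CMDiffAt ∞ (T% X) x)
    (hY : CMDiffAt ∞ (T% Y) x) :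
    mvfderiv I (fun y ↦ inner ℝ (X y) (Y y)) x (Z x)
      = inner ℝ (mlieBracket I Z X x) (Y x) + inner ℝ (X x) (mlieBracket I Z Y x) := by
  have := hZ.lieDeriv_metric x X Y hX hY
  rw [lieDerivMetric] at this
  linarith

variable [Nontrivial E]

/-- The Lie derivative of the Levi-Civita connection, `(L_Z ∇)(X, Y)`. -/
def lieDerivLeviCivita (Z X Y : Π x : M, TangentSpace I x) (x : M) : TangentSpace I x :=
  mlieBracket I Z (fun y ↦ leviCivita Y y (X y)) x - leviCivita Y x (mlieBracket I Z X x)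
    - leviCivita (mlieBracket I Z Y) x (X x)

/-- Symmetry comes from vanishing torsion: the difference of the two sides is the Jacobi identity
for $Z$, $X$, $Y$ with brackets of the form $[X,Y]$ rewritten as $\nabla_XY-\nabla_YX$. -/
theorem lieDerivLeviCivita_comm (hZ : SmoothNear Z x) (hX : SmoothNear X x) (hY : SmoothNear Y x) :
    lieDerivLeviCivita Z X Y x = lieDerivLeviCivita Z Y X x := by
  have h1 := mlieBracket_jacobi hZ hX hY
  have h2 : mlieBracket I X Y =ᶠ[𝓝 x] fun y ↦ leviCivita Y y (X y) - leviCivita X y (Y y) := by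
    filter_upwards [hX.eventually, hY.eventually] with y hX hY
    exact (leviCivita_sub_leviCivita hX.mdiff hY.mdiff).symm
  rw [mlieBracket_congr_right h2, mlieBracket_fun_sub_right (hX.leviCivita hY).mdiff
    (hY.leviCivita hX).mdiff, ← leviCivita_sub_leviCivita (hZ.mlieBracket hX).mdiff hY.mdiff,
    ← leviCivita_sub_leviCivita hX.mdiff (hZ.mlieBracket hY).mdiff, sub_eq_iff_eq_add] at h1
  rw [lieDerivLeviCivita, lieDerivLeviCivita, h1]
  abel

/-- Skewness comes from metric compatibility: compute $[Z,X]\,g(Y,W)$ as a commutator of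
derivatives, using $L_Zg=0$ for those along $Z$ and $\nabla g=0$ for those along $X$. -/
theorem IsKilling.inner_lieDerivLeviCivita (hZ : IsKilling Z) (hX : SmoothNear X x)
    (hY : SmoothNear Y x) (hW : SmoothNear W x) :
    inner ℝ (lieDerivLeviCivita Z X Y x) (W x) + inner ℝ (Y x) (lieDerivLeviCivita Z X W x) = 0 := by
  have hZ' : SmoothNear Z x := hZ.smoothNear
  have h1 := mvfderiv_mlieBracket (hY.inner hW) hZ' hX
  have h2 : (fun y ↦ mvfderiv I (fun y ↦ inner ℝ (Y y) (W y)) y (X y)) =ᶠ[𝓝 x] fun y ↦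
      inner ℝ (leviCivita Y y (X y)) (W y) + inner ℝ (Y y) (leviCivita W y (X y)) := by
    filter_upwards [hX.eventually, hY.eventually, hW.eventually] with y hX hY hW
    exact mvfderiv_inner_eq_leviCivita hX.mdiff hY.mdiff hW.mdiff
  have h3 : (fun y ↦ mvfderiv I (fun y ↦ inner ℝ (Y y) (W y)) y (Z y)) =ᶠ[𝓝 x] fun y ↦
      inner ℝ (mlieBracket I Z Y y) (W y) + inner ℝ (Y y) (mlieBracket I Z W y) := by
    filter_upwards [hY.eventually, hW.eventually] with y hY hW
    exact hZ.mvfderiv_inner hY.contMDiffAt hW.contMDiffAt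
  have hXY := hX.leviCivita hY
  have hXW := hX.leviCivita hW
  have hZY := hZ'.mlieBracket hY
  have hZW := hZ'.mlieBracket hW
  rw [mvfderiv_congr h2, mvfderiv_congr h3, mvfderiv_fun_add (hXY.inner hW).mdiff
    (hY.inner hXW).mdiff, mvfderiv_fun_add (hZY.inner hW).mdiff (hY.inner hZW).mdiff,
    mvfderiv_inner_eq_leviCivita (hZ'.mlieBracket hX).mdiff hY.mdiff hW.mdiff] at h1
  simp only [add_apply] at h1
  rw [hZ.mvfderiv_inner hXY.contMDiffAt hW.contMDiffAt,
    hZ.mvfderiv_inner hY.contMDiffAt hXW.contMDiffAt,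
    mvfderiv_inner_eq_leviCivita hX.mdiff hZY.mdiff hW.mdiff,
    mvfderiv_inner_eq_leviCivita hX.mdiff hY.mdiff hZW.mdiff] at h1
  simp only [lieDerivLeviCivita, inner_sub_left, inner_sub_right]
  linarith

/-- The trilinear expression $g((L_Z\nabla)(X,Y),W)$ is symmetric in $X,Y$ and skew in $Y,W$, hence
zero, as in the uniqueness of the Levi-Civita connection. -/
theorem IsKilling.lieDerivLeviCivita_eq_zero (hZ : IsKilling Z) (hX : SmoothNear X x)
    (hY : SmoothNear Y x) : lieDerivLeviCivita Z X Y x = 0 := by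
  refine ext_inner_right ℝ fun w ↦ ?_
  have hW : SmoothNear (extend E w) x := smoothNear_extend w
  have hZ' : SmoothNear Z x := hZ.smoothNear
  set W : Π x : M, TangentSpace I x := extend E w
  have hw : W x = w := extend_apply_self E w
  have h1 := hZ.inner_lieDerivLeviCivita hX hY hW
  have h2 := hZ.inner_lieDerivLeviCivita hW hX hY
  have h3 := hZ.inner_lieDerivLeviCivita hY hX hW
  rw [lieDerivLeviCivita_comm hZ' hX hW] at h1
  rw [lieDerivLeviCivita_comm hZ' hW hY] at h2
  rw [lieDerivLeviCivita_comm hZ' hY hX] at h3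
  rw [inner_zero_left, ← hw]
  have h4 := real_inner_comm (lieDerivLeviCivita Z W X x) (Y x)
  linarith

theorem IsKilling.mlieBracket_leviCivita (hZ : IsKilling Z) (hX : SmoothNear X x)
    (hY : SmoothNear Y x) :
    mlieBracket I Z (fun y ↦ leviCivita Y y (X y)) x
      = leviCivita Y x (mlieBracket I Z X x) + leviCivita (mlieBracket I Z Y) x (X x) := by
  have := hZ.lieDerivLeviCivita_eq_zero hX hY
  rwa [lieDerivLeviCivita, sub_sub, sub_eq_zero] at this

theorem IsKilling.mlieBracket_leviCivita_leviCivita (hZ : IsKilling Z) (hX : SmoothNear X x)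
    (hY : SmoothNear Y x) (hW : SmoothNear W x) :
    mlieBracket I Z (fun y ↦ leviCivita (fun y ↦ leviCivita W y (Y y)) y (X y)) x
      = leviCivita (fun y ↦ leviCivita W y (Y y)) x (mlieBracket I Z X x)
        + leviCivita (fun y ↦ leviCivita W y (mlieBracket I Z Y y)) x (X x)
        + leviCivita (fun y ↦ leviCivita (mlieBracket I Z W) y (Y y)) x (X x) := by
  have hZ' : SmoothNear Z x := hZ.smoothNear
  have h1 := (hZ'.mlieBracket hY).leviCivita hW
  have h2 := hY.leviCivita (hZ'.mlieBracket hW)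
  have h : mlieBracket I Z (fun y ↦ leviCivita W y (Y y)) =ᶠ[𝓝 x] fun y ↦
      leviCivita W y (mlieBracket I Z Y y) + leviCivita (mlieBracket I Z W) y (Y y) := by
    filter_upwards [hY.eventually, hW.eventually] with y hY hW
    exact hZ.mlieBracket_leviCivita hY hW
  rw [hZ.mlieBracket_leviCivita hX (hY.leviCivita hW),
    leviCivita_congr (hZ'.mlieBracket (hY.leviCivita hW)).mdiff (h1.add h2).mdiff h,
    leviCivita_add h1.mdiff h2.mdiff, add_assoc]

theorem SmoothNear.curvature (hX : SmoothNear X x) (hY : SmoothNear Y x) (hW : SmoothNear W x) :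
    SmoothNear (curvature X Y W) x :=
  ((hX.leviCivita (hY.leviCivita hW)).sub (hY.leviCivita (hX.leviCivita hW))).sub
    ((hX.mlieBracket hY).leviCivita hW)

/-- Curvature is made of $\nabla$ and the bracket; $L_Z$ obeys the product rule on both, by
$L_Z\nabla=0$ and by Jacobi. -/
theorem IsKilling.mlieBracket_curvature (hZ : IsKilling Z) (hX : SmoothNear X x)
    (hY : SmoothNear Y x) (hW : SmoothNear W x) :
    mlieBracket I Z (curvature X Y W) x
      = curvature (mlieBracket I Z X) Y W x + curvature X (mlieBracket I Z Y) W x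
        + curvature X Y (mlieBracket I Z W) x := by
  have hZ' : SmoothNear Z x := hZ.smoothNear
  have h1 : mlieBracket I Z (curvature X Y W) x = _ :=
    mlieBracket_fun_sub_right ((hX.leviCivita (hY.leviCivita hW)).sub
      (hY.leviCivita (hX.leviCivita hW))).mdiff ((hX.mlieBracket hY).leviCivita hW).mdiff
  rw [h1, mlieBracket_fun_sub_right (hX.leviCivita (hY.leviCivita hW)).mdiff
      (hY.leviCivita (hX.leviCivita hW)).mdiff, hZ.mlieBracket_leviCivita_leviCivita hX hY hW,
    hZ.mlieBracket_leviCivita_leviCivita hY hX hW,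
    hZ.mlieBracket_leviCivita (hX.mlieBracket hY) hW, mlieBracket_jacobi hZ' hX hY, map_add]
  simp only [curvature]
  abel

end LeviCivita

/-! ### Tensoriality of curvature, and invariance of the Ricci operator under Killing fields. -/

section Ricci

variable {E : Type*} [NormedAddCommGroup E] [NormedSpace ℝ E] [FiniteDimensional ℝ E]
  {H : Type*} [TopologicalSpace H] {I : ModelWithCorners ℝ E H}
  {M : Type*} [TopologicalSpace M] [ChartedSpace H M] [IsManifold I ∞ M]

/-- An operation `Φ` on vector fields that are smooth near `x` which is additive, local, and
homogeneous with respect to multiplication by smooth functions. -/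
structure IsTensorialNear {A : Type*} [AddCommGroup A] [Module ℝ A]
    (Φ : (Π x : M, TangentSpace I x) → A) (x : M) : Prop where
  add : ∀ {X Y : Π x : M, TangentSpace I x}, SmoothNear X x → SmoothNear Y x →
    Φ (fun y ↦ X y + Y y) = Φ X + Φ Y
  smul : ∀ {f : M → ℝ} {X : Π x : M, TangentSpace I x}, SmoothFunNear I f x → SmoothNear X x →
    Φ (fun y ↦ f y • X y) = f x • Φ X
  congr : ∀ {X Y : Π x : M, TangentSpace I x}, SmoothNear X x → X =ᶠ[𝓝 x] Y → Φ X = Φ Y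

variable [RiemannianBundle (fun x : M ↦ TangentSpace I x)]
  [IsContMDiffRiemannianBundle I ∞ E (fun x : M ↦ TangentSpace I x)]
  {X X' Y Y' W W' Z : Π x : M, TangentSpace I x} {f : M → ℝ} {x : M}

namespace IsTensorialNear

variable {A : Type*} [AddCommGroup A] [Module ℝ A] {Φ : (Π x : M, TangentSpace I x) → A}

theorem sum (hΦ : IsTensorialNear Φ x) {ι : Type*} {s : Finset ι}
    {X : ι → Π x : M, TangentSpace I x} (hX : ∀ i, SmoothNear (X i) x) :
    Φ (fun y ↦ ∑ i ∈ s, X i y) = ∑ i ∈ s, Φ (X i) := by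
  classical
  induction s using Finset.induction_on with
  | empty =>
    have h0 : SmoothNear (fun y ↦ ∑ i ∈ (∅ : Finset ι), X i y) x := .sum (by simp)
    -- The empty sum is the zero field, killed by homogeneity with the constant factor $0$.
    simpa using hΦ.smul (SmoothFunNear.const 0) h0
  | insert a s ha ih =>
    simp only [Finset.sum_insert ha]
    rw [hΦ.add (hX a) (.sum fun i _ ↦ hX i), ih]

theorem eq_sum (hΦ : IsTensorialNear Φ x) {e : Fin (finrank ℝ E) → Π x : M, TangentSpace I x}
    (he : IsOrthonormalFrameNear e x) (hX : SmoothNear X x) :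
    Φ X = ∑ i, (inner ℝ (e i x) (X x) : ℝ) • Φ (e i) := by
  have h (i) := SmoothNear.smul ((he.smooth i).inner hX) (he.smooth i)
  rw [← hΦ.congr (SmoothNear.sum fun i _ ↦ h i) (he.eventuallyEq_sum X), hΦ.sum h]
  exact Finset.sum_congr rfl fun i _ ↦ hΦ.smul ((he.smooth i).inner hX) (he.smooth i)

/-- Expansion in a local frame shows that only the coefficients at $x$ enter. -/
theorem pointwise (hΦ : IsTensorialNear Φ x) (hX : SmoothNear X x) (hY : SmoothNear Y x)
    (h : X x = Y x) : Φ X = Φ Y := by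
  obtain ⟨e, he⟩ := exists_isOrthonormalFrameNear (I := I) x
  rw [hΦ.eq_sum he hX, hΦ.eq_sum he hY, h]

theorem extend_add (hΦ : IsTensorialNear Φ x) (u v : TangentSpace I x) :
    Φ (extend E (u + v)) = Φ (extend E u) + Φ (extend E v) := by
  rw [← hΦ.add (smoothNear_extend u) (smoothNear_extend v)]
  exact hΦ.pointwise (smoothNear_extend _) ((smoothNear_extend u).add (smoothNear_extend v))
    (by simp)

theorem extend_smul (hΦ : IsTensorialNear Φ x) (c : ℝ) (u : TangentSpace I x) :
    Φ (extend E (c • u)) = c • Φ (extend E u) := by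
  rw [← hΦ.smul (f := fun _ ↦ c) (SmoothFunNear.const c) (smoothNear_extend u)]
  exact hΦ.pointwise (smoothNear_extend _) (.smul (SmoothFunNear.const c) (smoothNear_extend u))
    (by simp)

end IsTensorialNear

variable [Nontrivial E]

theorem curvature_swap : curvature X Y W x = -curvature Y X W x := by
  simp only [curvature]
  rw [mlieBracket_swap_apply, map_neg]
  abel

theorem isTensorialNear_curvature_left (hW : SmoothNear W x) :
    IsTensorialNear (fun X ↦ curvature X Y W x) x where
  add {X X'} hX hX' := by
    simp only [curvature, map_add]
    rw [leviCivita_add (hX.leviCivita hW).mdiff (hX'.leviCivita hW).mdiff,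
      mlieBracket_fun_add_left hX.mdiff hX'.mdiff, map_add]
    abel
  smul {f X} hf hX := by
    simp only [curvature, map_smul]
    rw [leviCivita_smul hf.mdiff (hX.leviCivita hW).mdiff,
      mlieBracket_fun_smul_left hf.mdiff hX.mdiff, map_add, map_smul, map_smul]
    module
  congr {X X'} hX h := by
    have h' : (fun y ↦ leviCivita W y (X y)) =ᶠ[𝓝 x] fun y ↦ leviCivita W y (X' y) :=
      h.mono fun y hy ↦ congrArg (leviCivita W y) hy
    have h'' : mlieBracket I X Y x = mlieBracket I X' Y x :=
      h.mlieBracket_vectorField_eq EventuallyEq.rfl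
    simp only [curvature]
    rw [h.self_of_nhds, leviCivita_congr (hX.leviCivita hW).mdiff
      ((hX.congr h).leviCivita hW).mdiff h', h'']

theorem isTensorialNear_curvature_middle (hW : SmoothNear W x) :
    IsTensorialNear (fun Y ↦ curvature X Y W x) x where
  add hY hY' := by
    have h := isTensorialNear_curvature_left (Y := X) hW
    simp only [fun Y ↦ curvature_swap (X := X) (Y := Y) (W := W) (x := x)]
    rw [h.add hY hY', neg_add]
  smul hf hY := by
    have h := isTensorialNear_curvature_left (Y := X) hW
    simp only [fun Y ↦ curvature_swap (X := X) (Y := Y) (W := W) (x := x)]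
    rw [h.smul hf hY, smul_neg]
  congr hY hYY' := by
    have h := isTensorialNear_curvature_left (Y := X) hW
    simp only [fun Y ↦ curvature_swap (X := X) (Y := Y) (W := W) (x := x)]
    rw [h.congr hY hYY']

theorem leviCivita_leviCivita_add (hY : SmoothNear Y x) (hW : SmoothNear W x)
    (hW' : SmoothNear W' x) (u : TangentSpace I x) :
    leviCivita (fun y ↦ leviCivita (fun z ↦ W z + W' z) y (Y y)) x u
      = leviCivita (fun y ↦ leviCivita W y (Y y)) x u
        + leviCivita (fun y ↦ leviCivita W' y (Y y)) x u := by
  have h : (fun y ↦ leviCivita (fun z ↦ W z + W' z) y (Y y)) =ᶠ[𝓝 x]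
      fun y ↦ leviCivita W y (Y y) + leviCivita W' y (Y y) := by
    filter_upwards [hW.eventually, hW'.eventually] with y h1 h2
    exact leviCivita_add h1.mdiff h2.mdiff _
  rw [leviCivita_congr (hY.leviCivita (hW.add hW')).mdiff
    ((hY.leviCivita hW).add (hY.leviCivita hW')).mdiff h,
    leviCivita_add (hY.leviCivita hW).mdiff (hY.leviCivita hW').mdiff]

theorem leviCivita_leviCivita_smul (hY : SmoothNear Y x) (hf : SmoothFunNear I f x)
    (hW : SmoothNear W x) (u : TangentSpace I x) :
    leviCivita (fun y ↦ leviCivita (fun z ↦ f z • W z) y (Y y)) x u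
      = f x • leviCivita (fun y ↦ leviCivita W y (Y y)) x u
        + mvfderiv I f x u • leviCivita W x (Y x) + mvfderiv I f x (Y x) • leviCivita W x u
        + mvfderiv I (fun y ↦ mvfderiv I f y (Y y)) x u • W x := by
  have h : (fun y ↦ leviCivita (fun z ↦ f z • W z) y (Y y)) =ᶠ[𝓝 x]
      fun y ↦ f y • leviCivita W y (Y y) + mvfderiv I f y (Y y) • W y := by
    filter_upwards [hf.eventually, hW.eventually] with y h1 h2
    exact leviCivita_smul h1.mdiff h2.mdiff _
  have h1 := SmoothNear.smul hf (hY.leviCivita hW)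
  have h2 := SmoothNear.smul (hf.mvfderiv hY) hW
  rw [leviCivita_congr (hY.leviCivita (.smul hf hW)).mdiff (h1.add h2).mdiff h,
    leviCivita_add h1.mdiff h2.mdiff, leviCivita_smul hf.mdiff (hY.leviCivita hW).mdiff,
    leviCivita_smul (hf.mvfderiv hY).mdiff hW.mdiff]
  abel

theorem leviCivita_leviCivita_congr (hY : SmoothNear Y x) (hW : SmoothNear W x)
    (h : W =ᶠ[𝓝 x] W') :
    leviCivita (fun y ↦ leviCivita W y (Y y)) x = leviCivita (fun y ↦ leviCivita W' y (Y y)) x := by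
  refine leviCivita_congr (hY.leviCivita hW).mdiff (hY.leviCivita (hW.congr h)).mdiff ?_
  filter_upwards [hW.eventually, h.eventuallyEq_nhds] with y h1 h2
  rw [leviCivita_congr h1.mdiff (h1.congr h2).mdiff h2]

/-- The first-derivative cross terms cancel by antisymmetry in $X,Y$; the second derivatives of $f$
combine to $[X,Y]f$, which the bracket term removes. -/
theorem isTensorialNear_curvature_right (hX : SmoothNear X x) (hY : SmoothNear Y x) :
    IsTensorialNear (fun W ↦ curvature X Y W x) x where
  add {W W'} hW hW' := by
    simp only [curvature]
    rw [leviCivita_leviCivita_add hY hW hW', leviCivita_leviCivita_add hX hW hW',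
      leviCivita_add hW.mdiff hW'.mdiff]
    abel
  smul {f W} hf hW := by
    simp only [curvature]
    rw [leviCivita_leviCivita_smul hY hf hW, leviCivita_leviCivita_smul hX hf hW,
      leviCivita_smul hf.mdiff hW.mdiff, mvfderiv_mlieBracket hf hX hY]
    module
  congr {W W'} hW h := by
    simp only [curvature]
    rw [leviCivita_leviCivita_congr hY hW h, leviCivita_leviCivita_congr hX hW h,
      leviCivita_congr hW.mdiff (hW.congr h).mdiff h]

theorem curvatureAt_eq (hX : SmoothNear X x) (hY : SmoothNear Y x) (hW : SmoothNear W x) :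
    curvatureAt x (X x) (Y x) (W x) = curvature X Y W x := by
  have h (u : TangentSpace I x) : SmoothNear (extend E u) x := smoothNear_extend u
  rw [curvatureAt, (isTensorialNear_curvature_left (h _)).pointwise (h _) hX (by simp),
    (isTensorialNear_curvature_middle (h _)).pointwise (h _) hY (by simp),
    (isTensorialNear_curvature_right hX hY).pointwise (h _) hW (by simp)]

/-- The Ricci operator is defined by a basis chosen separately at each point; a smooth frame may
replace it, which makes it differentiable as a field. -/
theorem ricciOperator_eq_sum {e : Fin (finrank ℝ E) → Π x : M, TangentSpace I x}
    (he : IsOrthonormalFrameNear e x) (hX : SmoothNear X x) :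
    ricciOperator x (X x) = ∑ i, curvature X (e i) (e i) x := by
  have h (u : TangentSpace I x) : SmoothNear (extend E u) x := smoothNear_extend u
  let B : TangentSpace I x →ₗ[ℝ] TangentSpace I x →ₗ[ℝ] TangentSpace I x :=
    LinearMap.mk₂ ℝ (curvatureAt x (X x))
      (fun u v w ↦ (isTensorialNear_curvature_middle (h _)).extend_add u v)
      (fun c u w ↦ (isTensorialNear_curvature_middle (h _)).extend_smul c u)
      (fun w u v ↦ (isTensorialNear_curvature_right (h _) (h _)).extend_add u v)
      (fun c w u ↦ (isTensorialNear_curvature_right (h _) (h _)).extend_smul c u)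
  obtain ⟨b, hb⟩ := he.exists_orthonormalBasis
  -- The tensor $\sum_i e_i\otimes e_i$ is the same for all orthonormal bases, hence so is its image
  -- under the bilinear map `B`.
  have h2 := congrArg (TensorProduct.lift B) ((InnerProductSpace.canonicalCovariantTensor_eq_sum _
    (stdOrthonormalBasis ℝ (TangentSpace I x))).symm.trans
    (InnerProductSpace.canonicalCovariantTensor_eq_sum _ b))
  simp only [map_sum, TensorProduct.lift.tmul, hb] at h2
  exact h2.trans (Finset.sum_congr rfl fun i _ ↦ curvatureAt_eq hX (he.smooth i) (he.smooth i))

/-- The frame need not be invariant under $Z$, but differentiating $g(e_i,e_j)=\delta_{ij}$ shows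
that the matrix $g(e_j,[Z,e_i])$ is skew, so the terms where $L_Z$ hits the frame cancel in the
trace. -/
theorem IsKilling.mlieBracket_ricciOperator (hZ : IsKilling Z) (hX : SmoothNear X x) :
    mlieBracket I Z (fun y ↦ ricciOperator y (X y)) x
      = ricciOperator x (mlieBracket I Z X x) := by
  obtain ⟨e, he⟩ := exists_isOrthonormalFrameNear (I := I) x
  have hZ' : SmoothNear Z x := hZ.smoothNear
  have hZe (i) := hZ'.mlieBracket (he.smooth i)
  have h : (fun y ↦ ricciOperator y (X y)) =ᶠ[𝓝 x] fun y ↦ ∑ i, curvature X (e i) (e i) y := by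
    filter_upwards [he.eventually, hX.eventually] with y h1 h2 using ricciOperator_eq_sum h1 h2
  refine (mlieBracket_congr_right h).trans ((mlieBracket_fun_sum_right
    fun i _ ↦ (hX.curvature (he.smooth i) (he.smooth i)).mdiff).trans ?_)
  rw [ricciOperator_eq_sum he (hZ'.mlieBracket hX)]
  simp only [hZ.mlieBracket_curvature hX (he.smooth _) (he.smooth _), Finset.sum_add_distrib]
  rw [add_assoc, add_eq_left]
  simp only [fun i ↦ (isTensorialNear_curvature_middle (X := X) (he.smooth i)).eq_sum he (hZe i),
    fun i ↦ (isTensorialNear_curvature_right hX (he.smooth i)).eq_sum he (hZe i)]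
  -- Exchanging the indices in one double sum leaves a common curvature factor times the symmetrised
  -- matrix.
  rw [Finset.sum_comm, ← Finset.sum_add_distrib]
  refine Finset.sum_eq_zero fun i _ ↦ ?_
  rw [← Finset.sum_add_distrib]
  refine Finset.sum_eq_zero fun j _ ↦ ?_
  rw [← add_smul]
  have h1 := hZ.mvfderiv_inner (he.smooth i).contMDiffAt (he.smooth j).contMDiffAt
  have h2 : (fun y ↦ (inner ℝ (e i y) (e j y) : ℝ)) =ᶠ[𝓝 x] fun _ ↦ if i = j then (1 : ℝ) else 0 :=
    he.eventually.mono fun y hy ↦ hy.inner_eq i j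
  rw [mvfderiv_congr h2, mvfderiv_const, real_inner_comm] at h1
  rw [add_comm, ← h1]
  simp

end Ricci

/-! ### Killing fields of a generalized Eta-Einstein contact metric structure. -/

section ContactKilling

variable {E : Type*} [NormedAddCommGroup E] [NormedSpace ℝ E] [FiniteDimensional ℝ E]
  {H : Type*} [TopologicalSpace H] {I : ModelWithCorners ℝ E H}
  {M : Type*} [TopologicalSpace M] [ChartedSpace H M] [IsManifold I ∞ M]
  [RiemannianBundle (fun x : M ↦ TangentSpace I x)]
  [IsContMDiffRiemannianBundle I ∞ E (fun x : M ↦ TangentSpace I x)]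
  {n : ℕ} {η : Π x : M, TangentSpace I x →L[ℝ] ℝ} {ξ : Π x : M, TangentSpace I x}
  {φ : Π x : M, TangentSpace I x →L[ℝ] TangentSpace I x} {lam gam : M → ℝ}
  {X Z : Π x : M, TangentSpace I x} {x : M}

namespace IsContactMetricStructure

theorem smoothNear_reeb (h : IsContactMetricStructure n η ξ φ) : SmoothNear ξ x :=
  Eventually.of_forall fun y ↦ h.contMDiff_reeb y

theorem inner_reeb_reeb (h : IsContactMetricStructure n η ξ φ) (x : M) :
    inner ℝ (ξ x) (ξ x) = (1 : ℝ) := by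
  rw [real_inner_self_eq_norm_sq, h.norm_reeb, one_pow]

/-- Skewness of $\phi$ is inherited from that of $d\eta$. -/
theorem inner_endo_swap (h : IsContactMetricStructure n η ξ φ) (u v : TangentSpace I x) :
    inner ℝ u (φ x v) = -inner ℝ v (φ x u) := by
  have h1 := h.d_eta x _ _ (smoothNear_extend u).contMDiffAt (smoothNear_extend v).contMDiffAt
  have h2 := h.d_eta x _ _ (smoothNear_extend v).contMDiffAt (smoothNear_extend u).contMDiffAt
  simp only [dOneForm, extend_apply_self] at h1 h2
  rw [mlieBracket_swap_apply, map_neg] at h2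
  linarith

/-- By skewness $g(\xi,\phi^2u)=-g(\phi u,\phi\xi)=0$, while $\phi^2=-\mathrm{Id}+\eta\otimes\xi$
evaluates the left side as $\eta(u)-g(\xi,u)$. -/
theorem eta_eq (h : IsContactMetricStructure n η ξ φ) (u : TangentSpace I x) :
    η x u = inner ℝ (ξ x) u := by
  have h1 := h.inner_endo_swap (ξ x) (φ x u)
  have h2 := h.inner_endo_swap (φ x u) (ξ x)
  rw [h.endo_sq, inner_add_right, inner_neg_right, real_inner_smul_right, h.inner_reeb_reeb,
    h.endo_reeb, inner_zero_right] at h1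
  linarith

theorem eta_eq_fun (h : IsContactMetricStructure n η ξ φ) (X : Π x : M, TangentSpace I x) :
    (fun y ↦ η y (X y)) = fun y ↦ inner ℝ (ξ y) (X y) :=
  funext fun _ ↦ h.eta_eq _

theorem contMDiffAt_endo (h : IsContactMetricStructure n η ξ φ) (hX : CMDiffAt ∞ (T% X) x) :
    CMDiffAt ∞ (T% fun y ↦ φ y (X y)) x :=
  ContMDiffAt.clm_bundle_apply (F₁ := E) (E₁ := fun x : M ↦ TangentSpace I x) (F₂ := E)
    (E₂ := fun x : M ↦ TangentSpace I x) (h.contMDiff_endo x) hX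

theorem mdifferentiableAt_endo (h : IsContactMetricStructure n η ξ φ) (hX : MDiffAt (T% X) x) :
    MDiffAt (T% fun y ↦ φ y (X y)) x :=
  MDifferentiableAt.clm_bundle_apply (F₁ := E) (E₁ := fun x : M ↦ TangentSpace I x) (F₂ := E)
    (E₂ := fun x : M ↦ TangentSpace I x)
    ((h.contMDiff_endo x).mdifferentiableAt (by simp)) hX

theorem smoothNear_endo (h : IsContactMetricStructure n η ξ φ) (hX : SmoothNear X x) :
    SmoothNear (fun y ↦ φ y (X y)) x :=
  hX.mono fun _ hy ↦ h.contMDiffAt_endo hy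

theorem tensorialAt_lieDerivEndo (h : IsContactMetricStructure n η ξ φ) :
    TensorialAt I E (fun X ↦ lieDerivEndo Z φ X x) x where
  smul {f X} hf hX := by
    simp only [lieDerivEndo, Pi.smul_apply', map_smul]
    rw [mlieBracket_fun_smul_right hf (h.mdifferentiableAt_endo hX), mlieBracket_smul_right hf hX,
      map_add, map_smul, map_smul]
    module
  add {X X'} hX hX' := by
    simp only [lieDerivEndo, Pi.add_apply, map_add]
    rw [mlieBracket_fun_add_right (h.mdifferentiableAt_endo hX) (h.mdifferentiableAt_endo hX'),
      mlieBracket_add_right hX hX', map_add]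
    abel

variable [Nontrivial E]

/-- This is $L_Zd\eta=0$: from $[Z,\xi]=0$ and $L_Zg=0$ follows $Z(\eta(V))=\eta([Z,V])$ (`key`),
and this passes to $d\eta$ through the commutator of derivatives (`key2`) and Jacobi. -/
theorem mvfderiv_dOneForm (h : IsContactMetricStructure n η ξ φ) (hZ : IsKilling Z)
    (hξ : mlieBracket I Z ξ = 0) {X Y : Π x : M, TangentSpace I x} (hX : SmoothNear X x)
    (hY : SmoothNear Y x) :
    mvfderiv I (dOneForm η X Y) x (Z x)
      = dOneForm η (mlieBracket I Z X) Y x + dOneForm η X (mlieBracket I Z Y) x := by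
  have hZ' : SmoothNear Z x := hZ.smoothNear
  have hr : SmoothNear ξ x := h.smoothNear_reeb
  have key {V : Π x : M, TangentSpace I x} {y : M} (hV : SmoothNear V y) :
      mvfderiv I (fun y ↦ inner ℝ (ξ y) (V y)) y (Z y) = inner ℝ (ξ y) (mlieBracket I Z V y) := by
    rw [hZ.mvfderiv_inner (h.contMDiff_reeb y) hV.contMDiffAt, hξ, Pi.zero_apply, inner_zero_left,
      zero_add]
  have key2 {V W : Π x : M, TangentSpace I x} (hV : SmoothNear V x) (hW : SmoothNear W x) :
      mvfderiv I (fun y ↦ mvfderiv I (fun y ↦ inner ℝ (ξ y) (V y)) y (W y)) x (Z x)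
        = mvfderiv I (fun y ↦ inner ℝ (ξ y) (V y)) x (mlieBracket I Z W x)
          + mvfderiv I (fun y ↦ inner ℝ (ξ y) (mlieBracket I Z V y)) x (W x) := by
    rw [mvfderiv_mlieBracket (hr.inner hV) hZ' hW, mvfderiv_congr
      (hV.eventually.mono fun y hy ↦ key hy :
      (fun y ↦ mvfderiv I (fun y ↦ inner ℝ (ξ y) (V y)) y (Z y)) =ᶠ[𝓝 x] _)]
    abel
  have hd (X Y : Π x : M, TangentSpace I x) : dOneForm η X Y = fun y ↦
      mvfderiv I (fun y ↦ inner ℝ (ξ y) (Y y)) y (X y)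
        - mvfderiv I (fun y ↦ inner ℝ (ξ y) (X y)) y (Y y)
        - inner ℝ (ξ y) (mlieBracket I X Y y) := by
    funext y
    rw [dOneForm, h.eta_eq, h.eta_eq_fun, h.eta_eq_fun]
  have h1 := (hr.inner hY).mvfderiv hX
  have h2 := (hr.inner hX).mvfderiv hY
  have h3 := hX.mlieBracket hY
  rw [hd, hd, hd, mvfderiv_fun_sub (h1.sub h2).mdiff (hr.inner h3).mdiff,
    mvfderiv_fun_sub h1.mdiff h2.mdiff]
  simp only [sub_apply]
  rw [key2 hY hX, key2 hX hY, key h3, mlieBracket_jacobi hZ' hX hY, inner_add_right]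
  ring

theorem lieDerivEndo_eq_zero (h : IsContactMetricStructure n η ξ φ) (hZ : IsKilling Z)
    (hξ : mlieBracket I Z ξ = 0) (hX : MDiffAt (T% X) x) : lieDerivEndo Z φ X x = 0 := by
  have hY : SmoothNear (extend E (X x)) x := smoothNear_extend (X x)
  -- Here $X$ is only differentiable at $x$; tensoriality allows replacing it by an extension of its
  -- value that is smooth near $x$.
  rw [h.tensorialAt_lieDerivEndo.pointwise hX hY.mdiff (by simp)]
  set Y : Π x : M, TangentSpace I x := extend E (X x)
  refine ext_inner_left ℝ fun w ↦ ?_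
  have hW : SmoothNear (extend E w) x := smoothNear_extend w
  set W : Π x : M, TangentSpace I x := extend E w
  have hw : W x = w := extend_apply_self E w
  have hZ' : SmoothNear Z x := hZ.smoothNear
  have hφ := h.smoothNear_endo hY
  have h1 := h.mvfderiv_dOneForm hZ hξ hW hY
  have h2 : dOneForm η W Y =ᶠ[𝓝 x] fun y ↦ 2 * inner ℝ (W y) (φ y (Y y)) := by
    filter_upwards [hW, hY] with y h1 h2 using h.d_eta y W Y h1 h2
  rw [mvfderiv_congr h2, mvfderiv_fun_mul mdifferentiableAt_const (hW.inner hφ).mdiff,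
    h.d_eta x _ _ (hZ'.mlieBracket hW).contMDiffAt hY.contMDiffAt,
    h.d_eta x _ _ hW.contMDiffAt (hZ'.mlieBracket hY).contMDiffAt, mvfderiv_const] at h1
  simp only [smul_apply, smul_zero, add_zero, smul_eq_mul] at h1
  rw [hZ.mvfderiv_inner hW.contMDiffAt hφ.contMDiffAt] at h1
  rw [← hw, lieDerivEndo, inner_sub_right, inner_zero_right]
  linarith

theorem lieDerivOneForm_eq_zero (h : IsContactMetricStructure n η ξ φ) (hZ : IsKilling Z)
    (hξ : mlieBracket I Z ξ = 0) (hX : CMDiffAt ∞ (T% X) x) : lieDerivOneForm Z η X x = 0 := by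
  rw [lieDerivOneForm, h.eta_eq_fun, h.eta_eq, hZ.mvfderiv_inner (h.contMDiff_reeb x) hX, hξ]
  simp

theorem inner_reeb_mlieBracket (h : IsContactMetricStructure n η ξ φ) (hZ : IsKilling Z) (x : M) :
    inner ℝ (ξ x) (mlieBracket I Z ξ x) = (0 : ℝ) := by
  have h1 := hZ.mvfderiv_inner (h.contMDiff_reeb x) (h.contMDiff_reeb x)
  rw [funext h.inner_reeb_reeb, mvfderiv_const, real_inner_comm] at h1
  simp only [zero_apply] at h1
  linarith

/-- This is $(L_ZQ)v=0$ written out, with $(L_Z\eta)(v)=g([Z,\xi],v)$. -/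
theorem lieDeriv_ricciOperator (h : IsContactMetricStructure n η ξ φ)
    (hE : IsGeneralizedEtaEinstein η ξ lam gam) (hZ : IsKilling Z) (v : TangentSpace I x) :
    mvfderiv I lam x (Z x) • v
      + (mvfderiv I gam x (Z x) * inner ℝ (ξ x) v
        + gam x * inner ℝ (mlieBracket I Z ξ x) v) • ξ x
      + (gam x * inner ℝ (ξ x) v) • mlieBracket I Z ξ x = 0 := by
  have hX : SmoothNear (extend E v) x := smoothNear_extend v
  set X : Π x : M, TangentSpace I x := extend E v
  have hv : X x = v := extend_apply_self E v
  have hr : SmoothNear ξ x := h.smoothNear_reeb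
  have hl : SmoothFunNear I lam x := Eventually.of_forall fun y ↦ hE.contMDiff_lam y
  have hg : SmoothFunNear I gam x := Eventually.of_forall fun y ↦ hE.contMDiff_gam y
  have hgη := hg.mul (hr.inner hX)
  have h1 := hZ.mlieBracket_ricciOperator hX
  have h2 : (fun y ↦ ricciOperator y (X y))
      = fun y ↦ lam y • X y + (gam y * inner ℝ (ξ y) (X y)) • ξ y :=
    funext fun y ↦ by rw [hE.ricci, h.eta_eq]
  rw [h2, mlieBracket_fun_add_right (SmoothNear.smul hl hX).mdiff (SmoothNear.smul hgη hr).mdiff,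
    mlieBracket_fun_smul_right hl.mdiff hX.mdiff, mlieBracket_fun_smul_right hgη.mdiff hr.mdiff,
    hE.ricci, h.eta_eq, mvfderiv_fun_mul hg.mdiff (hr.inner hX).mdiff] at h1
  simp only [add_apply, smul_apply, smul_eq_mul] at h1
  rw [hZ.mvfderiv_inner hr.contMDiffAt hX.contMDiffAt, hv, ← sub_eq_zero] at h1
  rw [← h1]
  module

theorem mvfderiv_add_eq_zero (h : IsContactMetricStructure n η ξ φ)
    (hE : IsGeneralizedEtaEinstein η ξ lam gam) (hZ : IsKilling Z) (x : M) :
    mvfderiv I lam x (Z x) + mvfderiv I gam x (Z x) = 0 := by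
  have h1 := congrArg (inner ℝ (ξ x)) (h.lieDeriv_ricciOperator hE hZ (ξ x))
  simp only [inner_add_right, real_inner_smul_right, h.inner_reeb_reeb,
    h.inner_reeb_mlieBracket hZ, real_inner_comm (ξ x) (mlieBracket I Z ξ x), inner_zero_right] at h1
  linarith

theorem smul_mlieBracket_reeb (h : IsContactMetricStructure n η ξ φ)
    (hE : IsGeneralizedEtaEinstein η ξ lam gam) (hZ : IsKilling Z) (x : M) :
    gam x • mlieBracket I Z ξ x = 0 := by
  have h1 := h.lieDeriv_ricciOperator hE hZ (ξ x)
  rw [real_inner_comm (ξ x) (mlieBracket I Z ξ x), h.inner_reeb_mlieBracket hZ,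
    h.inner_reeb_reeb, mul_zero, add_zero, mul_one, mul_one, ← add_smul, h.mvfderiv_add_eq_zero hE hZ, zero_smul, zero_add] at h1
  exact h1

/-- In dimension greater than one there is a nonzero $v\perp\xi$; pairing $(L_ZQ)v=0$ with this $v$
leaves $(Z\lambda)|v|^2=0$. No condition on the zeros of $\gamma$ enters. -/
theorem mvfderiv_lam_eq_zero (h : IsContactMetricStructure n η ξ φ)
    (hE : IsGeneralizedEtaEinstein η ξ lam gam) (hZ : IsKilling Z) (hd : 1 < finrank ℝ E) (x : M) :
    mvfderiv I lam x (Z x) = 0 := by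
  have hr : finrank ℝ (ℝ ∙ ξ x)ᗮ ≠ 0 := by
    have h1 := (ℝ ∙ ξ x).finrank_add_finrank_orthogonal
    have h2 : finrank ℝ (ℝ ∙ ξ x) = 1 :=
      finrank_span_singleton (norm_ne_zero_iff.1 (by rw [h.norm_reeb]; exact one_ne_zero))
    have h3 : finrank ℝ (TangentSpace I x) = finrank ℝ E := rfl
    omega
  obtain ⟨v, hv, hv0⟩ := Submodule.exists_mem_ne_zero_of_ne_bot
    (mt Submodule.finrank_eq_zero.2 hr)
  have hv' : inner ℝ (ξ x) v = (0 : ℝ) := Submodule.mem_orthogonal_singleton_iff_inner_right.1 hv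
  have h1 := congrArg (inner ℝ v) (h.lieDeriv_ricciOperator hE hZ v)
  simp only [inner_add_right, real_inner_smul_right, hv', real_inner_comm (ξ x) v, mul_zero,
    zero_mul, add_zero, inner_zero_right] at h1
  exact (mul_eq_zero.1 h1).resolve_right (inner_self_ne_zero.2 hv0)

theorem mlieBracket_reeb_eq_zero (h : IsContactMetricStructure n η ξ φ)
    (hE : IsGeneralizedEtaEinstein η ξ lam gam) (hZ : IsKilling Z)
    (hgam : Dense {x : M | gam x ≠ 0}) : mlieBracket I Z ξ = 0 := by
  have hs (x : M) : SmoothNear (mlieBracket I Z ξ) x :=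
    SmoothNear.mlieBracket hZ.smoothNear h.smoothNear_reeb
  have hc : Continuous fun y ↦ (inner ℝ (mlieBracket I Z ξ y) (mlieBracket I Z ξ y) : ℝ) :=
    continuous_iff_continuousAt.2 fun x ↦ ((hs x).inner (hs x)).contMDiffAt.continuousAt
  have h0 := hc.ext_on hgam continuous_const (g := fun _ ↦ (0 : ℝ)) fun y hy ↦ by
    simp only [(smul_eq_zero.1 (h.smul_mlieBracket_reeb hE hZ y)).resolve_left hy, inner_zero_left]
  exact funext fun y ↦ inner_self_eq_zero.1 (congrFun h0 y)

theorem isInfinitesimalAutomorphism (h : IsContactMetricStructure n η ξ φ) (hZ : IsKilling Z)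
    (hξ : mlieBracket I Z ξ = 0) : IsInfinitesimalAutomorphism η ξ φ Z where
  contMDiff := hZ.contMDiff
  lieDeriv_eta _ _ hX := h.lieDerivOneForm_eq_zero hZ hξ hX
  lieDeriv_reeb x := congrFun hξ x
  lieDeriv_endo _ _ hX := h.lieDerivEndo_eq_zero hZ hξ (hX.mdifferentiableAt (by simp))
  lieDeriv_metric := hZ.lieDeriv_metric

end IsContactMetricStructure

end ContactKilling

/-- An interior point of `s` would give a nonempty open set in a chart image, which has positive
Lebesgue measure. -/
theorem IsNullSet.dense_compl {d : ℕ} {M : Type*} [TopologicalSpace M]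
    [ChartedSpace (EuclideanSpace ℝ (Fin d)) M] {s : Set M} (hs : IsNullSet (d := d) s) :
    Dense sᶜ := by
  rw [← interior_eq_empty_iff_dense_compl, Set.eq_empty_iff_forall_notMem]
  intro x hx
  let c := chartAt (EuclideanSpace ℝ (Fin d)) x
  have hopen : IsOpen (c '' (c.source ∩ interior s)) :=
    c.isOpen_image_of_subset_source (c.open_source.inter isOpen_interior) Set.inter_subset_left
  refine (hopen.measure_pos volume ⟨c x, x, ⟨mem_chart_source _ x, hx⟩, rfl⟩).ne' ?_
  exact measure_mono_null (Set.image_mono (Set.inter_subset_inter_right _ interior_subset)) (hs x)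

end ContactMetric

end

theorem mainTheorem5 {n : ℕ} (hn : 1 ≤ n) {M : Type*} [TopologicalSpace M] [T2Space M]
    [ChartedSpace (EuclideanSpace ℝ (Fin (2 * n + 1))) M] [IsManifold (𝓡 (2 * n + 1)) ∞ M]
    [RiemannianBundle (fun x : M ↦ TangentSpace (𝓡 (2 * n + 1)) x)]
    [IsContMDiffRiemannianBundle (𝓡 (2 * n + 1)) ∞ (EuclideanSpace ℝ (Fin (2 * n + 1)))
      (fun x : M ↦ TangentSpace (𝓡 (2 * n + 1)) x)]
    (η : Π x : M, TangentSpace (𝓡 (2 * n + 1)) x →L[ℝ] ℝ)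
    (ξ : Π x : M, TangentSpace (𝓡 (2 * n + 1)) x)
    (φ : Π x : M, TangentSpace (𝓡 (2 * n + 1)) x →L[ℝ] TangentSpace (𝓡 (2 * n + 1)) x)
    (lam gam : M → ℝ)
    (hcontact : ContactMetric.IsContactMetricStructure n η ξ φ)
    (hEinstein : ContactMetric.IsGeneralizedEtaEinstein η ξ lam gam)
    (hgam : ContactMetric.IsNullSet (d := 2 * n + 1) {x : M | gam x = 0})
    (Z : Π x : M, TangentSpace (𝓡 (2 * n + 1)) x) (hZ : ContactMetric.IsKilling Z) :
    ContactMetric.IsInfinitesimalAutomorphism η ξ φ Z ∧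
      (∀ x : M, mvfderiv (𝓡 (2 * n + 1)) lam x (Z x) = 0) ∧
      (∀ x : M, mvfderiv (𝓡 (2 * n + 1)) gam x (Z x) = 0) := by
  have hd : finrank ℝ (EuclideanSpace ℝ (Fin (2 * n + 1))) = 2 * n + 1 := finrank_euclideanSpace_fin
  have hlam := hcontact.mvfderiv_lam_eq_zero hEinstein hZ (by omega)
  refine ⟨hcontact.isInfinitesimalAutomorphism hZ
    (hcontact.mlieBracket_reeb_eq_zero hEinstein hZ hgam.dense_compl), hlam, fun x ↦ ?_⟩
  have h := hcontact.mvfderiv_add_eq_zero hEinstein hZ x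
  rwa [hlam x, zero_add] at h
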